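/- **Setting.** Let $\mathcal S\subset\mathbb R^{m}$ and $\mathcal A\subset\mathbb R^{k}$ be nonempty compact sets, $\mathcal Z=\mathcal S\times\mathcal A\subset\mathbb R^d$ with $d=m+k$. Consider a discounted MDP with discount factor $\gamma\in(0,1)$, transition distribution $P(\cdot\mid s,a)$ on $\mathcal S$, and measurable reward $r:\mathcal Z\to[0,1]$ such that $a\mapsto r(s,a)$ is continuous for every $s$. For a (possibly random) policy $\pi$ let $V^\pi(s)=\mathbb E\big[\sum_{t\ge0}\gamma^t r(s_t,a_t)\mid s_0=s\big]$, where $a_t\sim\pi(\cdot\mid s_t)$ and $s_{t+1}\sim P(\cdot\mid s_t,a_t)$, and let $V^*(s)=\sup_\pi V^\pi(s)$. Let $K$ be a continuous positive semidefinite kernel on $\mathcal Z$ with $K(z,z)\le1$, let $\mathcal H_K$ be its RKHS, and let $\lambda>0$. For points $U=(z_1,\dots,z_J)$ (repetitions allowed) put $K_U=[K(z_i,z_j)]_{i,j}$, $k_U(z)=[K(z,z_j)]_j$, $$\Sigma_U^2(z)=K(z,z)-k_U(z)^\top(K_U+\lambda^2I)^{-1}k_U(z),\qquad \Gamma_{K,\lambda}(J)=\sup_{U\in\mathcal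 Z^J}\tfrac12\log\det\big(I_J+\lambda^{-2}K_U\big).$$ **Assumption 1 (discretization), with constant $c_0>0$.** For all integers $n\ge1$ and reals $B\ge1$ there is a finite set $D\subset\mathcal Z$ with $|D|\le c_0B^dn^d$ such that, for a choice $[z]\in D$ of a Euclidean-closest point to each $z\in\mathcal Z$, $f(z)-f([z])\le 1/n$ for all $z$ and all $f\in\mathcal H_K$ with $\|f\|_{\mathcal H_K}\le B$. **Assumption 2 (RKHS norm bound).** With respect to a finite measure $\nu$ on $\mathcal S$ (for instance Lebesgue measure, or counting measure if $\mathcal S$ is finite), $P(\cdot\mid z)$ has a density $p(\cdot\mid z)\ge0$ for every $z\in\mathcal Z$, and $\|p(s'\mid\cdot)\|_{\mathcal H_K}\le1$ for every $s'\in\mathcal S$. Write $c=\nu(\mathcal S)$ for the volume of $\mathcal S$. **Algorithm (KQLearn) with $J\ge1$ points and $L\ge1$ rounds.** Choose successively $z_j\in\arg\max_{z\in\mathcal Z}\Sigma^2_{(z_1,\dots,z_{j-1})}(z)$ for $j=1,\dots,J$ (ties broken arbitrarily), and put $U=(z_1,\dots,z_J)$. For $Y\in\mathbb R^J$ let $\widehat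 Q_Y(z)=r(z)+\gamma\,k_U(z)^\top(K_U+\lambda^2I_J)^{-1}Y$. Set $Y^{(0)}=0$. In round $\ell=1,\dots,L$ draw independent samples $s'_{\ell,j}\sim P(\cdot\mid z_j)$, $j=1,\dots,J$, independent of the earlier rounds, and let $Y^{(\ell)}_j$ be the projection of $\max_{a\in\mathcal A}\widehat Q_{Y^{(\ell-1)}}(s'_{\ell,j},a)$ onto $[0,\frac1{1-\gamma}]$. The output is a policy $\pi$ that selects in every state $s$ an action (almost surely) in $\arg\max_{a\in\mathcal A}\widehat Q^{(L)}(s,a)$, where $\widehat Q^{(L)}=\widehat Q_{Y^{(L)}}$. **Theorem.** For every $c_0>0$ there is a constant $C>0$, depending only on $c_0$, such that in the setting above, under Assumptions 1 and 2, for every $\delta\in(0,1)$, with probability at least $1-\delta$ over the $JL$ samples, every such output policy $\pi$ satisfies $$\|V^\pi-V^*\|_\infty\le 2\beta(\delta)\,\frac{\gamma}{(1-\gamma)^2}\sqrt{\frac{2\,\Gamma_{K,\lambda}(J)}{\log(1+1/\lambda^2)\,J}}+\frac{2\gamma^{L-1}}{(1-\gamma)^2},$$ where $$\beta(\delta)=C\left(\frac{c}{1-\gamma}+\frac{1}{2\lambda(1-\gamma)}\sqrt{d\,\log\frac{J}{(1-\gamma)\delta}}\right).$$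 -/

import Mathlib

open MeasureTheory ProbabilityTheory

noncomputable section

namespace KQ

/-! ### Discounted Markov decision processes -/

/-- A discounted Markov decision process with measurable reward in `[0,1]` and discount factor in
`(0,1)`. `P (s, a)` is the distribution of the next state. -/
structure MDP (S A : Type*) [MeasurableSpace S] [MeasurableSpace A] where
  P : Kernel (S × A) S
  r : S × A → ℝ
  γ : ℝ
  markov : IsMarkovKernel P
  measurable_r : Measurable r
  r_nonneg : ∀ z, 0 ≤ r z
  r_le_one : ∀ z, r z ≤ 1
  γ_pos : 0 < γ
  γ_lt_one : γ < 1

attribute [instance] MDP.markov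

/-- A (possibly random) policy: a probability distribution on actions for every state. -/
abbrev Policy (S A : Type*) [MeasurableSpace S] [MeasurableSpace A] :=
  {π : Kernel S A // IsMarkovKernel π}

instance {S A : Type*} [MeasurableSpace S] [MeasurableSpace A] (π : Policy S A) :
    IsMarkovKernel π.1 := π.2

namespace MDP

variable {S A : Type*} [MeasurableSpace S] [MeasurableSpace A]

/-- One step of the state-action chain: from `(s, a)` draw `s' ∼ P(· | s, a)`, then
`a' ∼ π(· | s')`. -/
def step (M : MDP S A) (π : Policy S A) : Kernel (S × A) (S × A) :=
  M.P ⊗ₖ Kernel.prodMkLeft (S × A) π.1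

instance (M : MDP S A) (π : Policy S A) : IsMarkovKernel (M.step π) := by
  unfold step; infer_instance

/-- The next state-action pair given the history up to time `n`: only the last pair matters. -/
def historyStep (M : MDP S A) (π : Policy S A) (n : ℕ) :
    Kernel ((i : Finset.Iic n) → S × A) (S × A) :=
  (M.step π).comap (fun h => h ⟨n, Finset.mem_Iic.2 le_rfl⟩) (measurable_pi_apply _)

instance (M : MDP S A) (π : Policy S A) (n : ℕ) : IsMarkovKernel (M.historyStep π n) := by
  unfold historyStep; infer_instance

/-- The law of the trajectory `(s₀, a₀), (s₁, a₁), …` under the policy `π` with `s₀ = s`. -/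
def trajLaw (M : MDP S A) (π : Policy S A) (s : S) : Measure (ℕ → S × A) :=
  Kernel.trajMeasure (X := fun _ => S × A) ((Measure.dirac s) ⊗ₘ π.1) (M.historyStep π)

/-- The value function `V^π(s) = 𝔼[∑ γ^t r(s_t, a_t) | s₀ = s]`. -/
def value (M : MDP S A) (π : Policy S A) (s : S) : ℝ :=
  ∫ ω, ∑' t : ℕ, M.γ ^ t * M.r (ω t) ∂(M.trajLaw π s)

/-- The optimal value function `V^*(s)`, the supremum of `V^π(s)` over all policies. -/
def optValue (M : MDP S A) (s : S) : ℝ := ⨆ π : Policy S A, M.value π s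

end MDP

/-! ### Kernel ridge regression -/

section Ridge

variable {Z : Type*}

/-- The kernel matrix of a finite sequence of points. -/
def gram (K : Z → Z → ℝ) {J : ℕ} (z : Fin J → Z) : Matrix (Fin J) (Fin J) ℝ :=
  Matrix.of fun i j => K (z i) (z j)

/-- The vector of kernel values between `x` and a finite sequence of points. -/
def kvec (K : Z → Z → ℝ) {J : ℕ} (z : Fin J → Z) (x : Z) : Fin J → ℝ := fun j => K x (z j)

/-- Kernel ridge regressor `k(x)ᵀ (K + λ² I)⁻¹ Y`. -/
def krr (K : Z → Z → ℝ) (lam : ℝ) {J : ℕ} (z : Fin J → Z) (Y : Fin J → ℝ) (x : Z) : ℝ :=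
  kvec K z x ⬝ᵥ Matrix.mulVec (gram K z + lam ^ 2 • (1 : Matrix (Fin J) (Fin J) ℝ))⁻¹ Y

/-- Squared uncertainty `Σ²(x) = K(x,x) - k(x)ᵀ (K + λ² I)⁻¹ k(x)`. -/
def uncertaintySq (K : Z → Z → ℝ) (lam : ℝ) {J : ℕ} (z : Fin J → Z) (x : Z) : ℝ :=
  K x x - krr K lam z (kvec K z x) x

/-- `z₁, …, z_J` is a maximum uncertainty design: each point maximizes over all of `Z` the
uncertainty given the points before it (ties are broken arbitrarily). -/
def IsMaxUncertaintyDesign (K : Z → Z → ℝ) (lam : ℝ) {J : ℕ} (z : Fin J → Z) : Prop :=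
  ∀ (j : Fin J) (x : Z),
    uncertaintySq K lam (fun i : Fin j => z (Fin.castLE j.isLt.le i)) x ≤
      uncertaintySq K lam (fun i : Fin j => z (Fin.castLE j.isLt.le i)) (z j)

/-- Maximal information gain of `J` points. -/
def infoGain (K : Z → Z → ℝ) (lam : ℝ) (J : ℕ) : ℝ :=
  ⨆ z : Fin J → Z,
    1 / 2 * Real.log ((1 : Matrix (Fin J) (Fin J) ℝ) + (1 / lam ^ 2) • gram K z).det

end Ridge

/-! ### Assumptions on the kernel -/

/-- `H` is the reproducing kernel Hilbert space of the real-valued kernel `K`. -/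
def IsRKHSOf {Z : Type*} (H : Type*) [NormedAddCommGroup H] [InnerProductSpace ℝ H]
    [CompleteSpace H] [RKHS ℝ H Z ℝ] (K : Z → Z → ℝ) : Prop :=
  ∀ x y, RKHS.kernel H x y 1 = K x y

/-- Squared Euclidean distance of state-action pairs, seen as points of `ℝ^{m + k}`. -/
def sqDist {m k : ℕ} {S : Set (EuclideanSpace ℝ (Fin m))} {A : Set (EuclideanSpace ℝ (Fin k))}
    (z z' : S × A) : ℝ :=
  dist z.1 z'.1 ^ 2 + dist z.2 z'.2 ^ 2

/-- Discretization assumption with constant `cD`: for all `n ≥ 1` and all `B ≥ 1` there is a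
finite set `D` of at most `cD (B n)^d` state-action pairs, `d = m + k`, such that `f z` exceeds
`f [z]` by at most `1 / n` whenever `‖f‖ ≤ B`, where `[z]` is a closest point of `D` to `z`. -/
def HasDiscretization {m k : ℕ} {S : Set (EuclideanSpace ℝ (Fin m))}
    {A : Set (EuclideanSpace ℝ (Fin k))} (H : Type*) [NormedAddCommGroup H]
    [InnerProductSpace ℝ H] [RKHS ℝ H (S × A) ℝ] (cD : ℝ) : Prop :=
  ∀ (n : ℕ) (B : ℝ), 1 ≤ n → 1 ≤ B →
    ∃ (D : Finset (S × A)) (near : S × A → S × A),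
      (D.card : ℝ) ≤ cD * B ^ (m + k) * (n : ℝ) ^ (m + k) ∧
      (∀ z, near z ∈ D ∧ ∀ z' ∈ D, sqDist (near z) z ≤ sqDist z' z) ∧
      ∀ f : H, ‖f‖ ≤ B → ∀ z, f z - f (near z) ≤ 1 / n

/-- The transition distribution has a density `p(s' | s, a)` with respect to `ν`, and for every
`s'` the function `p(s' | ·)` belongs to `H` with norm at most `1`. -/
def HasBoundedDensity {S A : Type*} [MeasurableSpace S] [MeasurableSpace A] (H : Type*)
    [NormedAddCommGroup H] [InnerProductSpace ℝ H] [RKHS ℝ H (S × A) ℝ]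
    (ν : Measure S) (P : Kernel (S × A) S) : Prop :=
  ∃ p : S → S × A → ℝ,
    (∀ s' z, 0 ≤ p s' z) ∧
    (∀ z, Measurable fun s' => p s' z) ∧
    (∀ z, P z = ν.withDensity fun s' => ENNReal.ofReal (p s' z)) ∧
    ∀ s', ∃ f : H, (∀ z, f z = p s' z) ∧ ‖f‖ ≤ 1

/-! ### The algorithm -/

section Algorithm

variable {S A : Type*} [MeasurableSpace S] [MeasurableSpace A]

/-- The proxy Q-function `r(x) + γ k(x)ᵀ (K + λ² I)⁻¹ Y` built from an observation vector. -/
def proxyQ (M : MDP S A) (K : S × A → S × A → ℝ) (lam : ℝ) {J : ℕ} (z : Fin J → S × A)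
    (Y : Fin J → ℝ) (x : S × A) : ℝ :=
  M.r x + M.γ * krr K lam z Y x

/-- The observation vectors `Y^{(ℓ)}`, where `ω ℓ j` is the transition sampled at `z j` in the
round number `ℓ` (rounds are counted from `0` here):
`Y^{(0)} = 0` and each new observation is the projection on `[0, 1 / (1 - γ)]` of the maximum over
the actions of the current proxy Q-function at the sampled state. -/
def observations (M : MDP S A) (K : S × A → S × A → ℝ) (lam : ℝ) {J L : ℕ} (z : Fin J → S × A)
    (ω : Fin L → Fin J → S) : (l : ℕ) → l ≤ L → Fin J → ℝ
  | 0, _ => 0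
  | l + 1, h => fun j =>
      max 0 (min (1 / (1 - M.γ))
        (⨆ a : A, proxyQ M K lam z (observations M K lam z ω l (Nat.le_of_succ_le h))
          (ω ⟨l, h⟩ j, a)))

/-- The output `Q̂^{(L)}` of the algorithm after `L` rounds. -/
def outputQ (M : MDP S A) (K : S × A → S × A → ℝ) (lam : ℝ) {J L : ℕ} (z : Fin J → S × A)
    (ω : Fin L → Fin J → S) : S × A → ℝ :=
  proxyQ M K lam z (observations M K lam z ω L le_rfl)

/-- The law of the `N = L J` samples of the generative model: independent, `ω ℓ j ∼ P(· | z j)`. -/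
def sampleLaw (M : MDP S A) (L : ℕ) {J : ℕ} (z : Fin J → S × A) :
    Measure (Fin L → Fin J → S) :=
  Measure.pi fun _ : Fin L => Measure.pi fun j : Fin J => M.P (z j)

/-- In every state the policy selects (almost surely) a maximizer of `Q`. -/
def IsGreedy (π : Policy S A) (Q : S × A → ℝ) : Prop :=
  ∀ s, ∀ᵐ a ∂(π.1 s), ∀ a', Q (s, a') ≤ Q (s, a)

end Algorithm

/-- The order of the confidence width multiplier `β(δ)`, where `c` is the volume of the state
space: `c / (1 - γ) + (2 λ (1 - γ))⁻¹ √(d log (J / ((1 - γ) δ)))`. -/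
def widthOrder (c γ lam : ℝ) (d J : ℕ) (δ : ℝ) : ℝ :=
  c / (1 - γ) + 1 / (2 * lam * (1 - γ)) * √(d * Real.log (J / ((1 - γ) * δ)))

end KQ

end

/-! Write φ for the feature map, c = ν(S), and σ² = 2Γ / (log(1 + λ⁻²) J).

One variational fact drives the regression (`ridge_objective`): Σ²(x) is the minimum over weights w
of ‖φ(x) - ∑ wᵢ φ(zᵢ)‖² + λ²|w|², attained at the weights by which ridge regression predicts at x.
So Σ(x) controls the bias, Σ(x)/λ controls the norm of the weights, and Σ² can only decrease when
points are added. The determinant in Γ is the product of the factors 1 + λ⁻²Σ² at the successive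
points (`det_succ`). The design takes a maximizer each time, so every factor dominates the final one
at any x, and J log(1 + λ⁻²Σ²(x)) ≤ 2Γ; concavity of the logarithm turns this into Σ² ≤ σ².

In one round the regression target is z ↦ ∫ p(s'|z) V(s') dν with 0 ≤ V ≤ 1/(1-γ) fixed by the
earlier rounds. It acts on features like an element of the RKHS of norm c/(1-γ), so the bias is at
most cΣ(x)/(1-γ). The noise at a fixed point is a weighted sum of independent bounded variables,
handled by Hoeffding; a union bound over a net makes it uniform (`exists_event`).

Three devices keep β free of L and of log(1/λ). (1) The exponent allowed in round l grows linearly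
with L - l. The failure probabilities then sum like a geometric series, while discounting makes the
larger errors of early rounds harmless (`abs_sub_backup_valueIter_le`). (2) The net has resolution
√τ/J with τ = min(1, max(s, λ²)), where s is the bound on Σ² before linearization. The resulting
log(1/τ) only occurs multiplied by s, and s log(1/τ) ≤ 7σ² (`mul_log_inv_mul_log_le`). (3) The part
of the rounding error without a factor 1/λ is of order 1/√J. It is at most cσ because a probability
density forces c‖φ(x)‖ ≥ 1 (`inv_sqrt_le_mul_uncertaintyBound`). Two cases escape this argument and
are treated by hand: d = 0, where there is no noise, and J = 1, where cσ ≥ 1 makes a crude bound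
enough.

For the policy, the comparison function is exact value iteration W from 0, not V*. By the
performance difference identity, W_L + γ^L/(1-γ) bounds every policy from above, and a policy greedy
for a Q within e of the backup of W_L loses at most 2e/(1-γ) against W_L. Neither an optimal policy
nor a measurable selection is needed. -/

namespace KQ

/-! ### Kernel ridge regression in a feature space -/

section RidgeRegression

open Matrix

variable {Z : Type*} {E : Type*} [NormedAddCommGroup E] [InnerProductSpace ℝ E]

/-- `φ` is a feature map of the kernel `K`. -/
def IsFeatureMap (φ : Z → E) (K : Z → Z → ℝ) : Prop := ∀ x y, inner ℝ (φ x) (φ y) = K x y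

/-- The regularized kernel matrix. -/
def regGram (K : Z → Z → ℝ) (lam : ℝ) {J : ℕ} (z : Fin J → Z) : Matrix (Fin J) (Fin J) ℝ :=
  gram K z + lam ^ 2 • (1 : Matrix (Fin J) (Fin J) ℝ)

/-- The weights that the ridge regressor at `x` puts on the observations. -/
noncomputable def ridgeWeights (K : Z → Z → ℝ) (lam : ℝ) {J : ℕ} (z : Fin J → Z) (x : Z) : Fin J → ℝ :=
  (regGram K lam z)⁻¹ *ᵥ kvec K z x

variable {φ : Z → E} {K : Z → Z → ℝ}

theorem IsFeatureMap.symm (h : IsFeatureMap φ K) (x y : Z) : K x y = K y x := by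
  rw [← h x y, ← h y x, real_inner_comm]

theorem IsFeatureMap.norm_sq (h : IsFeatureMap φ K) (x : Z) : ‖φ x‖ ^ 2 = K x x := by
  rw [← h x x, real_inner_self_eq_norm_sq]

theorem IsFeatureMap.diag_nonneg (h : IsFeatureMap φ K) (x : Z) : 0 ≤ K x x := by
  rw [← h.norm_sq]; positivity

theorem IsFeatureMap.abs_le (h : IsFeatureMap φ K) {b : ℝ} (hb : ∀ x, K x x ≤ b) (x y : Z) :
    |K x y| ≤ b := by
  rw [← h x y]
  have h1 := abs_real_inner_le_norm (φ x) (φ y)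
  have hx := (h.norm_sq x).trans_le (hb x)
  have hy := (h.norm_sq y).trans_le (hb y)
  nlinarith [sq_nonneg (‖φ x‖ - ‖φ y‖)]

theorem IsFeatureMap.inner_sum (h : IsFeatureMap φ K) {J : ℕ} (z : Fin J → Z) (w : Fin J → ℝ)
    (x : Z) : inner ℝ (φ x) (∑ i, w i • φ (z i)) = kvec K z x ⬝ᵥ w := by
  simp only [_root_.inner_sum, inner_smul_right, h _ _, kvec, dotProduct]
  exact Finset.sum_congr rfl fun i _ => mul_comm _ _

theorem IsFeatureMap.gram_quadForm (h : IsFeatureMap φ K) {J : ℕ} (z : Fin J → Z)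
    (w : Fin J → ℝ) : w ⬝ᵥ gram K z *ᵥ w = ‖∑ i, w i • φ (z i)‖ ^ 2 := by
  rw [← real_inner_self_eq_norm_sq, sum_inner]
  refine Finset.sum_congr rfl fun i _ => ?_
  rw [real_inner_smul_left, h.inner_sum]
  rfl

theorem IsFeatureMap.regGram_quadForm (h : IsFeatureMap φ K) (lam : ℝ) {J : ℕ} (z : Fin J → Z)
    (w : Fin J → ℝ) :
    w ⬝ᵥ regGram K lam z *ᵥ w = ‖∑ i, w i • φ (z i)‖ ^ 2 + lam ^ 2 * (w ⬝ᵥ w) := by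
  rw [regGram, Matrix.add_mulVec, dotProduct_add, h.gram_quadForm, Matrix.smul_mulVec,
    Matrix.one_mulVec, dotProduct_smul, smul_eq_mul]

theorem IsFeatureMap.regGram_transpose (h : IsFeatureMap φ K) (lam : ℝ) {J : ℕ}
    (z : Fin J → Z) : (regGram K lam z)ᵀ = regGram K lam z := by
  have : (gram K z)ᵀ = gram K z := by
    ext i j
    exact h.symm _ _
  rw [regGram, transpose_add, this, transpose_smul, transpose_one]

theorem IsFeatureMap.regGram_dot_comm (h : IsFeatureMap φ K) (lam : ℝ) {J : ℕ}
    (z : Fin J → Z) (v w : Fin J → ℝ) :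
    v ⬝ᵥ regGram K lam z *ᵥ w = w ⬝ᵥ regGram K lam z *ᵥ v := by
  rw [dotProduct_mulVec, ← mulVec_transpose, h.regGram_transpose, dotProduct_comm]

theorem IsFeatureMap.regGram_posDef (h : IsFeatureMap φ K) {lam : ℝ} (hlam : 0 < lam) {J : ℕ}
    (z : Fin J → Z) : (regGram K lam z).PosDef := by
  refine Matrix.PosDef.of_dotProduct_mulVec_pos ?_ fun w hw => ?_
  · rw [Matrix.IsHermitian, conjTranspose_eq_transpose_of_trivial, h.regGram_transpose]
  · rw [star_trivial, h.regGram_quadForm]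
    have : 0 < w ⬝ᵥ w := by
      refine lt_of_le_of_ne ?_ fun h0 => hw (dotProduct_self_eq_zero.1 h0.symm)
      exact Finset.sum_nonneg fun i _ => mul_self_nonneg _
    positivity

theorem IsFeatureMap.isUnit_det_regGram (h : IsFeatureMap φ K) {lam : ℝ} (hlam : 0 < lam)
    {J : ℕ} (z : Fin J → Z) : IsUnit (regGram K lam z).det :=
  (h.regGram_posDef hlam z).det_pos.ne'.isUnit

theorem IsFeatureMap.regGram_mulVec_inv (h : IsFeatureMap φ K) {lam : ℝ} (hlam : 0 < lam)
    {J : ℕ} (z : Fin J → Z) (w : Fin J → ℝ) :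
    regGram K lam z *ᵥ ((regGram K lam z)⁻¹ *ᵥ w) = w := by
  rw [mulVec_mulVec, mul_nonsing_inv _ (h.isUnit_det_regGram hlam z), one_mulVec]

theorem IsFeatureMap.krr_eq_ridgeWeights (h : IsFeatureMap φ K) (lam : ℝ) {J : ℕ}
    (z : Fin J → Z) (Y : Fin J → ℝ) (x : Z) :
    krr K lam z Y x = ridgeWeights K lam z x ⬝ᵥ Y := by
  change kvec K z x ⬝ᵥ (regGram K lam z)⁻¹ *ᵥ Y = _
  rw [dotProduct_mulVec, ← mulVec_transpose, transpose_nonsing_inv, h.regGram_transpose]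
  rfl

/-- Completing the square in the ridge objective. -/
theorem IsFeatureMap.ridge_objective (h : IsFeatureMap φ K) {lam : ℝ} (hlam : 0 < lam) {J : ℕ}
    (z : Fin J → Z) (x : Z) (w : Fin J → ℝ) :
    ‖φ x - ∑ i, w i • φ (z i)‖ ^ 2 + lam ^ 2 * (w ⬝ᵥ w) =
      uncertaintySq K lam z x +
        (w - ridgeWeights K lam z x) ⬝ᵥ regGram K lam z *ᵥ (w - ridgeWeights K lam z x) := by
  have hv : regGram K lam z *ᵥ ridgeWeights K lam z x = kvec K z x :=
    h.regGram_mulVec_inv hlam z _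
  rw [uncertaintySq, h.krr_eq_ridgeWeights, norm_sub_sq_real, h.norm_sq, h.inner_sum,
    mulVec_sub, sub_dotProduct, dotProduct_sub, dotProduct_sub, hv,
    h.regGram_dot_comm lam z (ridgeWeights K lam z x) w, hv, h.regGram_quadForm,
    dotProduct_comm w (kvec K z x)]
  ring

theorem IsFeatureMap.uncertaintySq_eq (h : IsFeatureMap φ K) {lam : ℝ} (hlam : 0 < lam) {J : ℕ}
    (z : Fin J → Z) (x : Z) :
    uncertaintySq K lam z x = ‖φ x - ∑ i, ridgeWeights K lam z x i • φ (z i)‖ ^ 2 +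
      lam ^ 2 * (ridgeWeights K lam z x ⬝ᵥ ridgeWeights K lam z x) := by
  rw [h.ridge_objective hlam z x]
  simp

/-- The quadratic remainder in `ridge_objective` is nonnegative, so any explicit choice of weights
bounds the uncertainty from above. -/
theorem IsFeatureMap.uncertaintySq_le (h : IsFeatureMap φ K) {lam : ℝ} (hlam : 0 < lam) {J : ℕ}
    (z : Fin J → Z) (x : Z) (w : Fin J → ℝ) :
    uncertaintySq K lam z x ≤ ‖φ x - ∑ i, w i • φ (z i)‖ ^ 2 + lam ^ 2 * (w ⬝ᵥ w) := by
  rw [h.ridge_objective hlam z x w]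
  have := (h.regGram_posDef hlam z).posSemidef.dotProduct_mulVec_nonneg
    (w - ridgeWeights K lam z x)
  rw [star_trivial] at this
  linarith

theorem dotProduct_self_nonneg_real {J : ℕ} (w : Fin J → ℝ) : 0 ≤ w ⬝ᵥ w :=
  Finset.sum_nonneg fun _ _ => mul_self_nonneg _

theorem IsFeatureMap.uncertaintySq_nonneg (h : IsFeatureMap φ K) {lam : ℝ} (hlam : 0 < lam)
    {J : ℕ} (z : Fin J → Z) (x : Z) : 0 ≤ uncertaintySq K lam z x := by
  rw [h.uncertaintySq_eq hlam]
  have := dotProduct_self_nonneg_real (ridgeWeights K lam z x)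
  positivity

theorem IsFeatureMap.uncertaintySq_le_diag (h : IsFeatureMap φ K) {lam : ℝ} (hlam : 0 < lam)
    {J : ℕ} (z : Fin J → Z) (x : Z) : uncertaintySq K lam z x ≤ K x x := by
  refine (h.uncertaintySq_le hlam z x 0).trans_eq ?_
  simp [h.norm_sq]

/-- Penalty half of the ridge objective at its minimizer; it becomes the variance in Hoeffding's
inequality. The other half, `norm_sub_ridge_sq_le`, becomes the bias. -/
theorem IsFeatureMap.ridgeWeights_sq_le (h : IsFeatureMap φ K) {lam : ℝ} (hlam : 0 < lam)
    {J : ℕ} (z : Fin J → Z) (x : Z) :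
    lam ^ 2 * (ridgeWeights K lam z x ⬝ᵥ ridgeWeights K lam z x) ≤ uncertaintySq K lam z x := by
  rw [h.uncertaintySq_eq hlam]
  exact le_add_of_nonneg_left (by positivity)

theorem IsFeatureMap.norm_sub_ridge_sq_le (h : IsFeatureMap φ K) {lam : ℝ} (hlam : 0 < lam)
    {J : ℕ} (z : Fin J → Z) (x : Z) :
    ‖φ x - ∑ i, ridgeWeights K lam z x i • φ (z i)‖ ^ 2 ≤ uncertaintySq K lam z x := by
  rw [h.uncertaintySq_eq hlam]
  have := dotProduct_self_nonneg_real (ridgeWeights K lam z x)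
  exact le_add_of_nonneg_right (by positivity)

theorem sum_extend_zero {V : Type*} [AddCommMonoid V] {I J : ℕ} {e : Fin I → Fin J}
    (he : Function.Injective e) (w : Fin I → ℝ) (g : ℝ → Fin J → V) (hg : ∀ j, g 0 j = 0) :
    ∑ j, g (Function.extend e w 0 j) j = ∑ i, g (w i) (e i) := by
  rw [← Finset.sum_subset (Finset.subset_univ (Finset.univ.image e)),
    Finset.sum_image he.injOn]
  · exact Finset.sum_congr rfl fun i _ => by rw [he.extend_apply]
  · intro j _ hj
    rw [Function.extend_apply' _ _ _ (by simpa using hj)]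
    exact hg j

/-- The uncertainty decreases when points are added to the design. -/
theorem IsFeatureMap.uncertaintySq_anti (h : IsFeatureMap φ K) {lam : ℝ} (hlam : 0 < lam)
    {I J : ℕ} (z : Fin J → Z) (e : Fin I → Fin J) (he : Function.Injective e) (x : Z) :
    uncertaintySq K lam z x ≤ uncertaintySq K lam (fun i => z (e i)) x := by
  set w := ridgeWeights K lam (fun i => z (e i)) x with hw
  -- The optimal weights of the smaller design, extended by zero, compete in the larger one with the
  -- same objective.
  refine (h.uncertaintySq_le hlam z x (Function.extend e w 0)).trans_eq ?_
  rw [h.uncertaintySq_eq hlam]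
  have h1 := sum_extend_zero he w (fun r j => r • φ (z j)) (by simp)
  have h2 := sum_extend_zero he w (fun r _ => r * r) (by simp)
  simp only [dotProduct]
  rw [h1, h2]

/-- The norm in the feature space of the ridge interpolant of `ε`. -/
theorem IsFeatureMap.norm_interpolant_sq_le (h : IsFeatureMap φ K) {lam : ℝ} (hlam : 0 < lam)
    {J : ℕ} (z : Fin J → Z) (ε : Fin J → ℝ) :
    lam ^ 2 * ‖∑ i, ((regGram K lam z)⁻¹ *ᵥ ε) i • φ (z i)‖ ^ 2 ≤ ε ⬝ᵥ ε := by
  set α := (regGram K lam z)⁻¹ *ᵥ ε with hα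
  have h1 : α ⬝ᵥ ε = ‖∑ i, α i • φ (z i)‖ ^ 2 + lam ^ 2 * (α ⬝ᵥ α) := by
    rw [← h.regGram_quadForm, hα, h.regGram_mulVec_inv hlam]
  -- Expanding |ε - λ²α|² ≥ 0 and inserting h1 leaves |ε|² ≥ 2λ²‖∑ αᵢφ(zᵢ)‖² plus a nonnegative
  -- term.
  have h2 := dotProduct_self_nonneg_real (ε - lam ^ 2 • α)
  simp only [sub_dotProduct, dotProduct_sub, smul_dotProduct, dotProduct_smul, smul_eq_mul,
    dotProduct_comm ε α] at h2
  have h3 := dotProduct_self_nonneg_real α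
  have h4 : lam ^ 2 * ‖∑ i, α i • φ (z i)‖ ^ 2 =
      lam ^ 2 * (α ⬝ᵥ ε) - lam ^ 2 * (lam ^ 2 * (α ⬝ᵥ α)) := by rw [h1]; ring
  have h5 : 0 ≤ lam ^ 2 * (lam ^ 2 * (α ⬝ᵥ α)) := by positivity
  have h6 : 0 ≤ lam ^ 2 * ‖∑ i, α i • φ (z i)‖ ^ 2 := by positivity
  linarith

/-- The regressor as evaluation of a single vector, for rounding to a net; `krr_eq_ridgeWeights`
reads it as a weighted sum of observations, for concentration at a fixed point. -/
theorem IsFeatureMap.krr_eq_inner (h : IsFeatureMap φ K) (lam : ℝ) {J : ℕ} (z : Fin J → Z)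
    (Y : Fin J → ℝ) (x : Z) :
    krr K lam z Y x = inner ℝ (φ x) (∑ i, ((regGram K lam z)⁻¹ *ᵥ Y) i • φ (z i)) := by
  rw [h.inner_sum]; rfl

/-! ### The log-determinant and the information gain -/

theorem uncertaintySq_eq_kvec (K : Z → Z → ℝ) (lam : ℝ) {J : ℕ}
    (z : Fin J → Z) (x : Z) :
    uncertaintySq K lam z x = K x x - kvec K z x ⬝ᵥ (regGram K lam z)⁻¹ *ᵥ kvec K z x := rfl

theorem one_add_smul_gram {lam : ℝ} (hlam : 0 < lam) {J : ℕ} (z : Fin J → Z) :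
    1 + (1 / lam ^ 2) • gram K z = (1 / lam ^ 2) • regGram K lam z := by
  rw [regGram, smul_add, smul_smul, one_div_mul_cancel (by positivity), one_smul, add_comm]

/-- Adding a point multiplies the determinant by `1 + λ⁻² Σ²` at that point. -/
theorem IsFeatureMap.det_succ (h : IsFeatureMap φ K) {lam : ℝ} (hlam : 0 < lam) {J : ℕ}
    (z : Fin (J + 1) → Z) :
    (1 + (1 / lam ^ 2) • gram K z).det =
      (1 + (1 / lam ^ 2) • gram K (fun i : Fin J => z i.castSucc)).det *
        (1 + 1 / lam ^ 2 * uncertaintySq K lam (fun i : Fin J => z i.castSucc)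
          (z (Fin.last J))) := by
  set z' := fun i : Fin J => z i.castSucc with hz'
  set x := z (Fin.last J) with hx
  rw [one_add_smul_gram hlam, one_add_smul_gram hlam, det_smul, det_smul]
  let e : Fin J ⊕ Fin 1 ≃ Fin (J + 1) := finSumFinEquiv
  -- With the new point split off, the matrix is bordered, and its Schur complement is λ² + Σ² at
  -- that point.
  have hb : (regGram K lam z).submatrix e e =
      fromBlocks (regGram K lam z') (of fun i (_ : Fin 1) => kvec K z' x i)
        (of fun (_ : Fin 1) i => kvec K z' x i) (of fun _ _ => K x x + lam ^ 2) := by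
    ext i j
    rcases i with i | i <;> rcases j with j | j
    · simp [e, regGram, gram, Matrix.one_apply, z', Fin.castSucc]
    · have : Fin.natAdd J j = Fin.last J := by ext; simp
      have h2 : Fin.castAdd 1 i ≠ Fin.last J := (Fin.castSucc_lt_last i).ne
      simp [e, regGram, gram, this, h2, kvec, x, z']
      exact h.symm _ _
    · have : Fin.natAdd J i = Fin.last J := by ext; simp
      have h2 : Fin.last J ≠ Fin.castAdd 1 j := (Fin.castSucc_lt_last j).ne'
      simp [e, regGram, gram, this, h2, kvec, x, z']
      rfl
    · have h1 : Fin.natAdd J i = Fin.last J := by ext; simp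
      have h2 : Fin.natAdd J j = Fin.last J := by ext; simp
      simp [e, regGram, gram, h1, h2, x]
  have hu := h.isUnit_det_regGram hlam z'
  have : Invertible (regGram K lam z') := Matrix.invertibleOfIsUnitDet _ hu
  rw [← det_submatrix_equiv_self e (regGram K lam z), hb, det_fromBlocks₁₁, det_fin_one,
    uncertaintySq_eq_kvec, invOf_eq_nonsing_inv]
  have : (of (fun (_ : Fin 1) i => kvec K z' x i) * (regGram K lam z')⁻¹ *
      of fun i (_ : Fin 1) => kvec K z' x i) 0 0 =
      kvec K z' x ⬝ᵥ (regGram K lam z')⁻¹ *ᵥ kvec K z' x := by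
    rw [Matrix.mul_assoc]
    rfl
  rw [Matrix.sub_apply, this]
  simp only [Fintype.card_fin, of_apply, pow_succ]
  field_simp
  ring

/-- The uncertainty of a maximum uncertainty design controls the determinants of its prefixes. -/
theorem IsMaxUncertaintyDesign.pow_le_det (h : IsFeatureMap φ K) {lam : ℝ} (hlam : 0 < lam)
    {J : ℕ} {z : Fin J → Z} (hz : IsMaxUncertaintyDesign K lam z) {s : ℝ} (hs : 0 ≤ s) {x : Z}
    (hx : s ≤ uncertaintySq K lam z x) :
    (1 + 1 / lam ^ 2 * s) ^ J ≤ (1 + (1 / lam ^ 2) • gram K z).det := by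
  have main : ∀ (n : ℕ) (hn : n ≤ J), (1 + 1 / lam ^ 2 * s) ^ n ≤
      (1 + (1 / lam ^ 2) • gram K (fun i : Fin n => z (Fin.castLE hn i))).det := by
    intro n
    induction n with
    | zero => intro _; simp
    | succ n ih =>
      intro hn
      rw [h.det_succ hlam, pow_succ]
      have h1 := ih (Nat.le_of_succ_le hn)
      have h2 := hz ⟨n, hn⟩ x
      have h3 := h.uncertaintySq_anti hlam z (Fin.castLE (Nat.le_of_succ_le hn))
        (Fin.castLE_injective _) x
      -- The uncertainty of the full design at x is at most that of the prefix at x, which is at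
      -- most that of the prefix at its chosen next point.
      have h4 : s ≤ uncertaintySq K lam
          (fun i : Fin n => z (Fin.castLE (Nat.le_of_succ_le hn) i)) (z ⟨n, hn⟩) :=
        hx.trans (h3.trans h2)
      have hpos : 0 < 1 / lam ^ 2 := by positivity
      refine mul_le_mul h1 ?_ (by positivity) ((by positivity : (0 : ℝ) ≤ _).trans h1)
      gcongr
      exact h4
  simpa using main J le_rfl

/-- The first uncertainty alone controls the determinant. -/
theorem IsFeatureMap.one_add_le_det (h : IsFeatureMap φ K) {lam : ℝ} (hlam : 0 < lam)
    {J : ℕ} (z : Fin (J + 1) → Z) :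
    1 + 1 / lam ^ 2 * K (z 0) (z 0) ≤ (1 + (1 / lam ^ 2) • gram K z).det := by
  induction J with
  | zero =>
    rw [h.det_succ hlam]
    simp [uncertaintySq, krr]
  | succ J ih =>
    rw [h.det_succ hlam]
    have h1 := ih fun i => z i.castSucc
    have h2 := h.uncertaintySq_nonneg hlam (fun i : Fin (J + 1) => z i.castSucc)
      (z (Fin.last _))
    have h3 := h.diag_nonneg (z 0)
    refine h1.trans (le_mul_of_one_le_right ((by positivity : (0 : ℝ) ≤ _).trans h1) ?_)
    have : 0 ≤ 1 / lam ^ 2 * uncertaintySq K lam (fun i : Fin (J + 1) => z i.castSucc)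
      (z (Fin.last _)) := by positivity
    linarith

/-- All entries are at most 1 + λ⁻² in absolute value, so the Leibniz formula gives a crude uniform
bound. Without boundedness the real supremum in `infoGain` would be the default value 0. -/
theorem IsFeatureMap.bddAbove_infoGain (h : IsFeatureMap φ K) (hK : ∀ x, K x x ≤ 1) {lam : ℝ}
    (hlam : 0 < lam) (J : ℕ) :
    BddAbove (Set.range fun z : Fin J → Z => 1 / 2 *
      Real.log ((1 : Matrix (Fin J) (Fin J) ℝ) + (1 / lam ^ 2) • gram K z).det) := by
  refine ⟨1 / 2 * Real.log (((Fintype.card (Fin J)).factorial •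
    (1 + 1 / lam ^ 2) ^ Fintype.card (Fin J) : ℝ)), ?_⟩
  rintro _ ⟨z, rfl⟩
  have hpos : 0 < (1 + (1 / lam ^ 2) • gram K z).det := by
    rw [one_add_smul_gram hlam, det_smul]
    have := (h.regGram_posDef hlam z).det_pos
    positivity
  dsimp only
  refine mul_le_mul_of_nonneg_left (Real.log_le_log hpos ?_) (by norm_num)
  refine (le_abs_self _).trans (Matrix.det_le (abv := AbsoluteValue.abs) fun i j => ?_)
  have h1 : |(1 : Matrix (Fin J) (Fin J) ℝ) i j| ≤ 1 := by
    rw [Matrix.one_apply]; split_ifs <;> simp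
  have h2 := h.abs_le hK (z i) (z j)
  have h3 : (0 : ℝ) < 1 / lam ^ 2 := by positivity
  calc AbsoluteValue.abs (((1 : Matrix (Fin J) (Fin J) ℝ) + (1 / lam ^ 2) • gram K z) i j)
      = |(1 : Matrix (Fin J) (Fin J) ℝ) i j + 1 / lam ^ 2 * K (z i) (z j)| := rfl
    _ ≤ 1 + 1 / lam ^ 2 * 1 := by
        refine (abs_add_le _ _).trans (add_le_add h1 ?_)
        rw [abs_mul, abs_of_pos h3]
        gcongr
    _ = 1 + 1 / lam ^ 2 := by rw [mul_one]

theorem IsFeatureMap.log_det_le (h : IsFeatureMap φ K) (hK : ∀ x, K x x ≤ 1) {lam : ℝ}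
    (hlam : 0 < lam) {J : ℕ} (z : Fin J → Z) :
    Real.log ((1 : Matrix (Fin J) (Fin J) ℝ) + (1 / lam ^ 2) • gram K z).det ≤
      2 * infoGain K lam J := by
  have := le_ciSup (h.bddAbove_infoGain hK hlam J) z
  change 1 / 2 * Real.log _ ≤ infoGain K lam J at this
  linarith

theorem IsMaxUncertaintyDesign.mul_log_le_infoGain (h : IsFeatureMap φ K)
    (hK : ∀ x, K x x ≤ 1) {lam : ℝ} (hlam : 0 < lam) {J : ℕ} {z : Fin J → Z}
    (hz : IsMaxUncertaintyDesign K lam z) (x : Z) :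
    J * Real.log (1 + 1 / lam ^ 2 * uncertaintySq K lam z x) ≤ 2 * infoGain K lam J := by
  refine le_trans ?_ (h.log_det_le hK hlam z)
  have h1 := hz.pow_le_det h hlam (h.uncertaintySq_nonneg hlam z x) le_rfl
  have h2 := h.uncertaintySq_nonneg hlam z x
  rw [← Real.log_pow]
  exact Real.log_le_log (by positivity) h1

/-- The first point of a maximum uncertainty design maximizes the diagonal of the kernel. -/
theorem IsMaxUncertaintyDesign.diag_le {lam : ℝ} {J : ℕ} {z : Fin (J + 1) → Z}
    (hz : IsMaxUncertaintyDesign K lam z) (x : Z) : K x x ≤ K (z 0) (z 0) := by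
  have h4 : ∀ (u : Fin ((0 : Fin (J + 1)) : ℕ) → Z) y, uncertaintySq K lam u y = K y y :=
    fun u y => by
      have : kvec K u y = 0 := funext fun i => absurd i.2 (by simp)
      rw [uncertaintySq, krr, this, zero_dotProduct, sub_zero]
  simpa only [h4] using hz 0 x

/-- The first point alone already carries this much information. The resulting lower bound on Γ
serves both for its sign and for `inv_sqrt_le_mul_uncertaintyBound`. -/
theorem IsMaxUncertaintyDesign.log_diag_le_infoGain (h : IsFeatureMap φ K)
    (hK : ∀ x, K x x ≤ 1) {lam : ℝ} (hlam : 0 < lam) {J : ℕ} (hJ : 1 ≤ J) {z : Fin J → Z}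
    (hz : IsMaxUncertaintyDesign K lam z) (x : Z) :
    Real.log (1 + 1 / lam ^ 2 * K x x) ≤ 2 * infoGain K lam J := by
  refine le_trans ?_ (h.log_det_le hK hlam z)
  obtain ⟨J, rfl⟩ : ∃ n, J = n + 1 := ⟨J - 1, by omega⟩
  have h1 := h.one_add_le_det hlam z
  have h2 := hz.diag_le x
  have h3 := h.diag_nonneg x
  refine Real.log_le_log (by positivity) (le_trans ?_ h1)
  gcongr

end RidgeRegression

/-! ### The law of the trajectory and the performance difference identity -/

namespace MDP

variable {S A : Type*} [MeasurableSpace S] [MeasurableSpace A]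

/-- The law of the state-action pair at time `t`. -/
noncomputable def lawAt (M : MDP S A) (π : Policy S A) (s : S) (t : ℕ) : Measure (S × A) :=
  (M.trajLaw π s).map fun ω => ω t

instance (M : MDP S A) (π : Policy S A) (s : S) : IsProbabilityMeasure (M.trajLaw π s) := by
  unfold trajLaw; infer_instance

instance (M : MDP S A) (π : Policy S A) (s : S) (t : ℕ) :
    IsProbabilityMeasure (M.lawAt π s t) :=
  Measure.isProbabilityMeasure_map (measurable_pi_apply t).aemeasurable

theorem lawAt_zero (M : MDP S A) (π : Policy S A) (s : S) :
    M.lawAt π s 0 = (Measure.dirac s) ⊗ₘ π.1 := by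
  have h : (M.trajLaw π s).map (Preorder.frestrictLe 0) =
      ((Measure.dirac s) ⊗ₘ π.1).map
        (MeasurableEquiv.piUnique (fun _ : Finset.Iic 0 => S × A)).symm := by
    unfold trajLaw Kernel.trajMeasure
    rw [Measure.map_comp _ _ (by fun_prop), Kernel.traj_map_frestrictLe, Kernel.partialTraj_self,
      Measure.id_comp]
  have h2 : M.lawAt π s 0 = ((M.trajLaw π s).map (Preorder.frestrictLe 0)).map
      fun h => h ⟨0, Finset.mem_Iic.2 le_rfl⟩ := by
    rw [Measure.map_map (by fun_prop) (by fun_prop)]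
    rfl
  rw [h2, h, Measure.map_map (by fun_prop) (by fun_prop)]
  exact Measure.map_id

theorem lawAt_succ (M : MDP S A) (π : Policy S A) (s : S) (t : ℕ) :
    M.lawAt π s (t + 1) = M.step π ∘ₘ M.lawAt π s t := by
  have h := Kernel.map_frestrictLe_trajMeasure_compProd_eq_map_trajMeasure
    (X := fun _ => S × A) (μ₀ := (Measure.dirac s) ⊗ₘ π.1) (κ := M.historyStep π) (a := t)
  have h2 : M.lawAt π s (t + 1) =
      ((M.trajLaw π s).map (Preorder.frestrictLe t) ⊗ₘ M.historyStep π t).map Prod.snd := by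
    unfold trajLaw
    rw [h, Measure.map_map (by fun_prop) (by fun_prop)]
    rfl
  rw [h2]
  ext B hB
  rw [← Measure.snd, Measure.snd_compProd, Measure.bind_apply hB (Kernel.aemeasurable _),
    Measure.bind_apply hB (Kernel.aemeasurable _), lawAt,
    lintegral_map (Kernel.measurable_coe _ hB) (by fun_prop),
    lintegral_map (Kernel.measurable_coe _ hB) (by fun_prop)]
  rfl

theorem integrable_of_bounded {X : Type*} [MeasurableSpace X] {μ : Measure X} [IsFiniteMeasure μ]
    {f : X → ℝ} (hf : Measurable f) {b : ℝ} (hb : ∀ x, |f x| ≤ b) : Integrable f μ :=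
  Integrable.of_bound hf.aestronglyMeasurable b (Filter.Eventually.of_forall hb)

/-- The expectation of `W` at the next state. -/
noncomputable def nextExp (M : MDP S A) (W : S → ℝ) (z : S × A) : ℝ := ∫ s', W s' ∂(M.P z)

theorem measurable_nextExp (M : MDP S A) {W : S → ℝ} (hW : Measurable W) :
    Measurable (M.nextExp W) :=
  (StronglyMeasurable.integral_kernel_prod_right (f := fun _ s' => W s')
    (hW.comp measurable_snd).stronglyMeasurable).measurable

theorem abs_nextExp_le (M : MDP S A) {W : S → ℝ} {b : ℝ} (hb : ∀ s, |W s| ≤ b) (z : S × A) :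
    |M.nextExp W z| ≤ b := by
  have := norm_integral_le_of_norm_le_const (μ := M.P z) (f := W) (Filter.Eventually.of_forall hb)
  simpa [nextExp] using this

/-- The state coordinate of a step is drawn from `P` alone, so the policy drops out. -/
theorem integral_fst_lawAt_succ (M : MDP S A) (π : Policy S A) (s : S) (t : ℕ) {W : S → ℝ}
    (hW : Measurable W) {b : ℝ} (hb : ∀ s, |W s| ≤ b) :
    ∫ z, W z.1 ∂(M.lawAt π s (t + 1)) = ∫ z, M.nextExp W z ∂(M.lawAt π s t) := by
  have hi : Integrable (fun z => W z.1) (M.step π ∘ₘ M.lawAt π s t) := by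
    have : IsProbabilityMeasure (M.step π ∘ₘ M.lawAt π s t) := by
      rw [← lawAt_succ]; infer_instance
    exact integrable_of_bounded (hW.comp measurable_fst) fun z => hb z.1
  have hbind : ∫ z, W z.1 ∂(M.step π ∘ₘ M.lawAt π s t) =
      ∫ z, ∫ x, W x.1 ∂(M.step π z) ∂(M.lawAt π s t) := by
    have h2 := Measure.integral_compProd
      ((Measure.integrable_compProd_snd_iff hi.aestronglyMeasurable).2 hi)
    rw [← Measure.snd_compProd] at hi ⊢
    rw [← h2, Measure.snd, integral_map (by fun_prop) hi.aestronglyMeasurable]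
  rw [lawAt_succ, hbind]
  · refine integral_congr_ae (Filter.Eventually.of_forall fun z => ?_)
    dsimp only
    have h1 : ∫ x, W x.1 ∂(M.step π z) = ∫ x, W x ∂((M.step π z).map Prod.fst) := by
      rw [integral_map (by fun_prop) hW.aestronglyMeasurable]
    rw [h1, ← Kernel.fst_apply, step, Kernel.fst_compProd]
    rfl

theorem integral_fst_lawAt_zero (M : MDP S A) (π : Policy S A) (s : S) {W : S → ℝ}
    (hW : Measurable W) : ∫ z, W z.1 ∂(M.lawAt π s 0) = W s := by
  have h1 : ∫ z, W z.1 ∂(M.lawAt π s 0) = ∫ x, W x ∂((M.lawAt π s 0).map Prod.fst) := by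
    rw [integral_map (by fun_prop) hW.aestronglyMeasurable]
  rw [h1, lawAt_zero, ← Measure.fst, Measure.fst_compProd,
    integral_dirac' _ _ hW.stronglyMeasurable]

/-- At every time the action is drawn from the policy given the state, so a property almost sure
under the policy in each state holds along the trajectory. -/
theorem ae_lawAt (M : MDP S A) (π : Policy S A) (s : S) (t : ℕ) {p : S × A → Prop}
    (hp : MeasurableSet {z | p z}) (h : ∀ s, ∀ᵐ a ∂(π.1 s), p (s, a)) :
    ∀ᵐ z ∂(M.lawAt π s t), p z := by
  cases t with
  | zero =>
    rw [lawAt_zero, Measure.ae_compProd_iff hp]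
    exact Filter.Eventually.of_forall h
  | succ t =>
    rw [lawAt_succ, Measure.ae_comp_iff hp]
    refine Filter.Eventually.of_forall fun z => ?_
    rw [step, Kernel.ae_compProd_iff hp]
    exact Filter.Eventually.of_forall h

theorem abs_r_le (M : MDP S A) (z : S × A) : |M.r z| ≤ 1 := by
  rw [abs_of_nonneg (M.r_nonneg z)]; exact M.r_le_one z

/-- The value function as a discounted series of expected rewards. -/
theorem hasSum_value (M : MDP S A) (π : Policy S A) (s : S) :
    HasSum (fun t => M.γ ^ t * ∫ z, M.r z ∂(M.lawAt π s t)) (M.value π s) := by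
  have hmeas : ∀ t, Measurable fun ω : ℕ → S × A => M.γ ^ t * M.r (ω t) := fun t =>
    (M.measurable_r.comp (measurable_pi_apply t)).const_mul _
  have hb : ∀ t (ω : ℕ → S × A), |M.γ ^ t * M.r (ω t)| ≤ M.γ ^ t := fun t ω => by
    have := M.γ_pos
    rw [abs_mul, abs_of_pos (by positivity)]
    exact mul_le_of_le_one_right (by positivity) (M.abs_r_le _)
  have hgeo : Summable fun t => M.γ ^ t :=
    summable_geometric_of_lt_one M.γ_pos.le M.γ_lt_one
  have h := hasSum_integral_of_summable_integral_norm (μ := M.trajLaw π s)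
    (F := fun t ω => M.γ ^ t * M.r (ω t))
    (fun t => integrable_of_bounded (hmeas t) (hb t)) ?_
  · have e : (fun t => M.γ ^ t * ∫ z, M.r z ∂(M.lawAt π s t)) =
        fun t => ∫ ω, M.γ ^ t * M.r (ω t) ∂(M.trajLaw π s) := by
      funext t
      rw [integral_const_mul, lawAt, integral_map (measurable_pi_apply t).aemeasurable
        M.measurable_r.aestronglyMeasurable]
    rw [e]
    exact h
  · refine Summable.of_nonneg_of_le (fun t => integral_nonneg fun ω => norm_nonneg _)
      (fun t => ?_) hgeo
    have h1 := integral_mono (μ := M.trajLaw π s)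
      (integrable_of_bounded (hmeas t) (hb t)).norm (integrable_const (M.γ ^ t)) (hb t)
    simpa using h1

/-- The Bellman advantage of the pair `z` with respect to the function `W`. -/
noncomputable def advantage (M : MDP S A) (W : S → ℝ) (z : S × A) : ℝ :=
  M.r z + M.γ * M.nextExp W z - W z.1

theorem measurable_advantage (M : MDP S A) {W : S → ℝ} (hW : Measurable W) :
    Measurable (M.advantage W) :=
  (M.measurable_r.add ((M.measurable_nextExp hW).const_mul _)).sub (hW.comp measurable_fst)

theorem abs_advantage_le (M : MDP S A) {W : S → ℝ} {b : ℝ} (hb : ∀ s, |W s| ≤ b) (z : S × A) :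
    |M.advantage W z| ≤ 1 + b + b := by
  have h1 := M.abs_r_le z
  have h2 := M.abs_nextExp_le hb z
  have h3 := hb z.1
  have h4 : |M.γ * M.nextExp W z| ≤ b := by
    rw [abs_mul, abs_of_pos M.γ_pos]
    exact (mul_le_of_le_one_left (abs_nonneg _) M.γ_lt_one.le).trans h2
  unfold advantage
  rw [abs_le] at *
  constructor <;> linarith [h1.1, h1.2, h3.1, h3.2, h4.1, h4.2]

/-- **Performance difference**: `V^π - W` is the discounted sum of the expected advantages. -/
theorem hasSum_value_sub (M : MDP S A) (π : Policy S A) (s : S) {W : S → ℝ}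
    (hW : Measurable W) {b : ℝ} (hb : ∀ s, |W s| ≤ b) :
    HasSum (fun t => M.γ ^ t * ∫ z, M.advantage W z ∂(M.lawAt π s t)) (M.value π s - W s) := by
  have hγ := M.γ_pos
  let u : ℕ → ℝ := fun t => M.γ ^ t * ∫ z, W z.1 ∂(M.lawAt π s t)
  have hu0 : u 0 = W s := by simp [u, M.integral_fst_lawAt_zero π s hW]
  -- Telescoping of γ^t 𝔼 W(s_t), whose terms tend to 0 because W is bounded.
  have htel : HasSum (fun t => u (t + 1) - u t) (-W s) := by
    have hs : Summable u := by
      refine Summable.of_norm_bounded (g := fun t => M.γ ^ t * b)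
        ((summable_geometric_of_lt_one hγ.le M.γ_lt_one).mul_right b) fun t => ?_
      rw [norm_mul, Real.norm_of_nonneg (by positivity)]
      refine mul_le_mul_of_nonneg_left ?_ (by positivity)
      have := norm_integral_le_of_norm_le_const (μ := M.lawAt π s t)
        (f := fun z => W z.1) (Filter.Eventually.of_forall fun z => hb z.1)
      simpa using this
    have h1 := (hasSum_nat_add_iff' 1).2 hs.hasSum
    have h2 := h1.sub hs.hasSum
    simpa [hu0] using h2
  have h := (M.hasSum_value π s).add htel
  rw [← sub_eq_add_neg] at h
  convert h using 1
  funext t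
  have hr : Integrable M.r (M.lawAt π s t) := integrable_of_bounded M.measurable_r M.abs_r_le
  have hn : Integrable (M.nextExp W) (M.lawAt π s t) :=
    integrable_of_bounded (M.measurable_nextExp hW) (M.abs_nextExp_le hb)
  have hw : Integrable (fun z : S × A => W z.1) (M.lawAt π s t) :=
    integrable_of_bounded (hW.comp measurable_fst) fun z => hb z.1
  have e : ∫ z, M.advantage W z ∂(M.lawAt π s t) = ∫ z, M.r z ∂(M.lawAt π s t) +
      M.γ * ∫ z, M.nextExp W z ∂(M.lawAt π s t) - ∫ z, W z.1 ∂(M.lawAt π s t) := by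
    unfold advantage
    have hn' := hn.const_mul M.γ
    have h1 := integral_sub (hr.add hn') hw
    have h2 := integral_add hr hn'
    simp only [Pi.add_apply] at h1
    rw [h1, h2, integral_const_mul]
  rw [e]
  simp only [u]
  rw [M.integral_fst_lawAt_succ π s t hW hb]
  ring

/-- A W whose advantages are at most η nearly satisfies the optimality inequality, hence dominates
every policy up to a geometric series in η. -/
theorem value_le_add (M : MDP S A) (π : Policy S A) (s : S) {W : S → ℝ}
    (hW : Measurable W) {b : ℝ} (hb : ∀ s, |W s| ≤ b) {η : ℝ}
    (hη : ∀ z, M.advantage W z ≤ η) : M.value π s ≤ W s + η / (1 - M.γ) := by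
  have h1 := M.hasSum_value_sub π s hW hb
  have h2 := (hasSum_geometric_of_lt_one M.γ_pos.le M.γ_lt_one).mul_right η
  have h3 := hasSum_le (fun t => ?_) h1 h2
  · rw [div_eq_inv_mul]; linarith
  · have := M.γ_pos
    refine mul_le_mul_of_nonneg_left ?_ (by positivity)
    have := integral_mono (μ := M.lawAt π s t)
      (integrable_of_bounded (M.measurable_advantage hW) (M.abs_advantage_le hb))
      (integrable_const η) hη
    simpa using this

theorem sub_le_value (M : MDP S A) (π : Policy S A) (s : S) {W : S → ℝ}
    (hW : Measurable W) {b : ℝ} (hb : ∀ s, |W s| ≤ b) {η : ℝ}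
    (hη : ∀ s, ∀ᵐ a ∂(π.1 s), -η ≤ M.advantage W (s, a)) :
    W s - η / (1 - M.γ) ≤ M.value π s := by
  have h1 := M.hasSum_value_sub π s hW hb
  have h2 := (hasSum_geometric_of_lt_one M.γ_pos.le M.γ_lt_one).mul_right (-η)
  have h3 := hasSum_le (fun t => ?_) h2 h1
  · rw [div_eq_inv_mul]; linarith
  · have := M.γ_pos
    refine mul_le_mul_of_nonneg_left ?_ (by positivity)
    have := integral_mono_ae (μ := M.lawAt π s t) (integrable_const (-η))
      (integrable_of_bounded (M.measurable_advantage hW) (M.abs_advantage_le hb))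
      (M.ae_lawAt π s t (measurableSet_le measurable_const (M.measurable_advantage hW)) hη)
    simpa using this

end MDP

/-! ### Suprema over a compact set of actions -/

section CompactSup

variable {A : Type*} [TopologicalSpace A]

theorem measurable_iSup_of_continuous {X : Type*} [MeasurableSpace X]
    [TopologicalSpace.SeparableSpace A] {F : X → A → ℝ} (hm : ∀ a, Measurable fun x => F x a)
    (hc : ∀ x, Continuous (F x)) : Measurable fun x => ⨆ a, F x a := by
  obtain ⟨T, hT, hd⟩ := TopologicalSpace.exists_countable_dense A
  have : Countable T := hT.to_subtype
  have e : (fun x => ⨆ a, F x a) = fun x => ⨆ a : T, F x a := by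
    funext x
    exact (hd.ciSup' (hc x)).symm
  rw [e]
  exact Measurable.iSup fun a => hm a

variable [CompactSpace A]

theorem le_ciSup_of_continuous {F : A → ℝ} (hF : Continuous F) (a : A) : F a ≤ ⨆ a, F a :=
  le_ciSup (isCompact_range hF).bddAbove a

theorem abs_ciSup_sub_le [Nonempty A] {F G : A → ℝ} (hF : Continuous F) (hG : Continuous G) {η : ℝ}
    (h : ∀ a, |F a - G a| ≤ η) : |(⨆ a, F a) - ⨆ a, G a| ≤ η := by
  have h1 : (⨆ a, F a) ≤ (⨆ a, G a) + η := ciSup_le fun a => by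
    have := le_ciSup_of_continuous hG a
    have := (abs_le.1 (h a)).2
    linarith
  have h2 : (⨆ a, G a) ≤ (⨆ a, F a) + η := ciSup_le fun a => by
    have := le_ciSup_of_continuous hF a
    have := (abs_le.1 (h a)).1
    linarith
  rw [abs_le]
  constructor <;> linarith

end CompactSup

/-! ### Clipping to the range of the value functions -/

namespace MDP

/-- The projection onto the interval `[0, 1 / (1 - γ)]` of possible values. -/
noncomputable def clip {S A : Type*} [MeasurableSpace S] [MeasurableSpace A] (M : MDP S A)
    (x : ℝ) : ℝ := max 0 (min (1 / (1 - M.γ)) x)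

/-- The clipped greedy value of a Q-function. -/
noncomputable def clippedValue {S A : Type*} [MeasurableSpace S] [MeasurableSpace A]
    (M : MDP S A) (Q : S × A → ℝ) (s : S) : ℝ := M.clip (⨆ a : A, Q (s, a))

section Clip

variable {S A : Type*} [MeasurableSpace S] [MeasurableSpace A] (M : MDP S A)

theorem one_sub_γ_pos : 0 < 1 - M.γ := sub_pos.2 M.γ_lt_one

theorem clip_nonneg (x : ℝ) : 0 ≤ M.clip x := le_max_left _ _

theorem clip_le (x : ℝ) : M.clip x ≤ 1 / (1 - M.γ) :=
  max_le (one_div_nonneg.2 M.one_sub_γ_pos.le) (min_le_left _ _)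

theorem clip_eq_self {x : ℝ} (h0 : 0 ≤ x) (h1 : x ≤ 1 / (1 - M.γ)) : M.clip x = x := by
  rw [clip, min_eq_right h1, max_eq_right h0]

theorem abs_clip_sub_le (x y : ℝ) : |M.clip x - M.clip y| ≤ |x - y| := by
  unfold clip
  rw [max_comm 0, max_comm 0, min_comm _ x, min_comm _ y]
  exact (abs_max_sub_max_le_abs _ _ _).trans (abs_inf_sub_inf_le_abs x y (1 / (1 - M.γ)))

theorem measurable_clip : Measurable M.clip :=
  measurable_const.max (measurable_const.min measurable_id)

theorem abs_clippedValue_le (Q : S × A → ℝ) (s : S) :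
    |M.clippedValue Q s| ≤ 1 / (1 - M.γ) := by
  rw [clippedValue, abs_of_nonneg (M.clip_nonneg _)]
  exact M.clip_le _

end Clip

/-! ### Value iteration -/

section ValueIteration

variable {S A : Type*} [MeasurableSpace S] [MeasurableSpace A] (M : MDP S A)

/-- The Q-function of a continuation value. -/
noncomputable def backup (W : S → ℝ) (z : S × A) : ℝ := M.r z + M.γ * M.nextExp W z

/-- Value iteration from `0`. -/
noncomputable def valueIter : ℕ → S → ℝ
  | 0 => 0
  | n + 1 => fun s => ⨆ a : A, M.backup (valueIter n) (s, a)

/-- The expected next value of a bounded function depends continuously on the action. -/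
def IsActionFeller [TopologicalSpace A] : Prop :=
  ∀ W : S → ℝ, Measurable W → (∃ b, ∀ s, |W s| ≤ b) → ∀ s, Continuous fun a => M.nextExp W (s, a)

theorem measurable_backup {W : S → ℝ} (hW : Measurable W) : Measurable (M.backup W) :=
  M.measurable_r.add ((M.measurable_nextExp hW).const_mul _)

theorem nextExp_mono {V W : S → ℝ} (hV : Measurable V) (hW : Measurable W) {b : ℝ}
    (hVb : ∀ s, |V s| ≤ b) (hWb : ∀ s, |W s| ≤ b) {η : ℝ} (h : ∀ s, V s ≤ W s + η) (z : S × A) :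
    M.nextExp V z ≤ M.nextExp W z + η := by
  have hi := integrable_of_bounded (μ := M.P z) hW hWb
  have h1 := integral_mono (integrable_of_bounded (μ := M.P z) hV hVb)
    (hi.add (integrable_const η)) h
  have h2 := integral_add hi (integrable_const (μ := M.P z) η)
  simp only [Pi.add_apply] at h1
  rw [h2] at h1
  simpa [nextExp] using h1

variable [TopologicalSpace A]

theorem continuous_backup (hr : ∀ s, Continuous fun a => M.r (s, a)) (hP : M.IsActionFeller)
    {W : S → ℝ} (hW : Measurable W) {b : ℝ} (hb : ∀ s, |W s| ≤ b) (s : S) :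
    Continuous fun a => M.backup W (s, a) :=
  (hr s).add (continuous_const.mul (hP W hW ⟨b, hb⟩ s))

theorem measurable_clippedValue [TopologicalSpace.SeparableSpace A] {Q : S × A → ℝ}
    (hm : Measurable Q)
    (hc : ∀ s, Continuous fun a => Q (s, a)) : Measurable (M.clippedValue Q) :=
  M.measurable_clip.comp
    (measurable_iSup_of_continuous (fun _ => hm.comp measurable_prodMk_right) hc)

variable [CompactSpace A] [Nonempty A] [TopologicalSpace.SeparableSpace A]

theorem valueIter_spec (hr : ∀ s, Continuous fun a => M.r (s, a)) (hP : M.IsActionFeller)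
    (n : ℕ) : Measurable (M.valueIter n) ∧
      ∀ s, 0 ≤ M.valueIter n s ∧ M.valueIter n s ≤ 1 / (1 - M.γ) := by
  have hγ := M.one_sub_γ_pos
  induction n with
  | zero => exact ⟨measurable_const, fun s => ⟨le_rfl, by simp [valueIter, hγ.le]⟩⟩
  | succ n ih =>
    obtain ⟨hm, hb⟩ := ih
    have hb' : ∀ s, |M.valueIter n s| ≤ 1 / (1 - M.γ) := fun s => by
      rw [abs_of_nonneg (hb s).1]; exact (hb s).2
    have hc := M.continuous_backup hr hP hm hb'
    refine ⟨measurable_iSup_of_continuous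
      (fun a => (M.measurable_backup hm).comp measurable_prodMk_right) hc, fun s => ⟨?_, ?_⟩⟩
    · obtain ⟨a⟩ := ‹Nonempty A›
      refine le_trans ?_ (le_ciSup_of_continuous (hc s) a)
      have h1 : 0 ≤ M.nextExp (M.valueIter n) (s, a) := integral_nonneg fun s' => (hb s').1
      have := M.γ_pos
      have := M.r_nonneg (s, a)
      unfold backup
      positivity
    · refine ciSup_le fun a => ?_
      have h1 := (abs_le.1 (M.abs_nextExp_le hb' (s, a))).2
      have h2 := mul_le_mul_of_nonneg_left h1 M.γ_pos.le
      have h3 : 1 / (1 - M.γ) = 1 + M.γ * (1 / (1 - M.γ)) := by field_simp; ring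
      unfold backup
      have := M.r_le_one (s, a)
      linarith

theorem abs_valueIter_le (hr : ∀ s, Continuous fun a => M.r (s, a)) (hP : M.IsActionFeller)
    (n : ℕ) (s : S) : |M.valueIter n s| ≤ 1 / (1 - M.γ) := by
  obtain ⟨h1, h2⟩ := (M.valueIter_spec hr hP n).2 s
  rwa [abs_of_nonneg h1]

theorem backup_le (hr : ∀ s, Continuous fun a => M.r (s, a)) (hP : M.IsActionFeller)
    (n : ℕ) (s : S) (a : A) : M.backup (M.valueIter n) (s, a) ≤ M.valueIter (n + 1) s :=
  le_ciSup_of_continuous (M.continuous_backup hr hP (M.valueIter_spec hr hP n).1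
    (M.abs_valueIter_le hr hP n) s) a

/-- Since 0 ≤ r ≤ 1, the first increment lies in [0, 1]; the backup is monotone and contracts
constants by γ, which propagates both bounds. -/
theorem valueIter_succ (hr : ∀ s, Continuous fun a => M.r (s, a)) (hP : M.IsActionFeller)
    (n : ℕ) : ∀ s, M.valueIter n s ≤ M.valueIter (n + 1) s ∧
      M.valueIter (n + 1) s ≤ M.valueIter n s + M.γ ^ n := by
  have hγ := M.γ_pos
  have hm := fun n => (M.valueIter_spec hr hP n).1
  have hb := M.abs_valueIter_le hr hP
  induction n with
  | zero =>
    refine fun s => ⟨((M.valueIter_spec hr hP 1).2 s).1, ciSup_le fun a => ?_⟩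
    simpa [valueIter, backup, nextExp] using M.r_le_one (s, a)
  | succ n ih =>
    refine fun s => ⟨ciSup_le fun a => ?_, ciSup_le fun a => ?_⟩
    · refine le_trans ?_ (M.backup_le hr hP (n + 1) s a)
      have h1 := M.nextExp_mono (hm n) (hm (n + 1)) (hb n) (hb (n + 1)) (η := 0)
        (fun s => by simpa using (ih s).1) (s, a)
      unfold backup
      nlinarith
    · have h0 := M.backup_le hr hP n s a
      have h1 := M.nextExp_mono (hm (n + 1)) (hm n) (hb (n + 1)) (hb n) (fun s => (ih s).2) (s, a)
      unfold backup at h0 ⊢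
      have h2 := mul_le_mul_of_nonneg_left h1 hγ.le
      rw [pow_succ]
      linarith

theorem value_le_valueIter (hr : ∀ s, Continuous fun a => M.r (s, a)) (hP : M.IsActionFeller)
    (n : ℕ) (π : Policy S A) (s : S) :
    M.value π s ≤ M.valueIter n s + M.γ ^ n / (1 - M.γ) := by
  refine M.value_le_add π s (M.valueIter_spec hr hP n).1 (M.abs_valueIter_le hr hP n) fun z => ?_
  have h1 := M.backup_le hr hP n z.1 z.2
  have h2 := (M.valueIter_succ hr hP n z.1).2
  unfold backup at h1
  unfold advantage
  linarith

/-- A greedy action has W_n ≤ W_{n+1} ≤ Q + e ≤ backup + 2e, so its advantage with respect to W_n is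
at least -2e. -/
theorem valueIter_le_value_of_isGreedy (hr : ∀ s, Continuous fun a => M.r (s, a))
    (hP : M.IsActionFeller) (n : ℕ) {π : Policy S A} {Q : S × A → ℝ} (hQ : IsGreedy π Q) {e : ℝ}
    (he : ∀ z, |Q z - M.backup (M.valueIter n) z| ≤ e) (s : S) :
    M.valueIter n s - 2 * e / (1 - M.γ) ≤ M.value π s := by
  refine M.sub_le_value π s (M.valueIter_spec hr hP n).1 (M.abs_valueIter_le hr hP n) fun s => ?_
  filter_upwards [hQ s] with a ha
  have h1 : M.valueIter (n + 1) s ≤ Q (s, a) + e := ciSup_le fun a' => by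
    have h2 := (abs_le.1 (he (s, a'))).1
    have h3 := ha a'
    linarith
  have h2 := (M.valueIter_succ hr hP n s).1
  have h3 := (abs_le.1 (he (s, a))).2
  unfold backup at h3
  unfold advantage
  linarith

/-- The suboptimality of a policy that is greedy with respect to an approximate Q-function. -/
theorem abs_value_sub_optValue_le (hr : ∀ s, Continuous fun a => M.r (s, a))
    (hP : M.IsActionFeller) (n : ℕ) {π : Policy S A} {Q : S × A → ℝ} (hQ : IsGreedy π Q) {e : ℝ}
    (he : ∀ z, |Q z - M.backup (M.valueIter n) z| ≤ e) (s : S) :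
    |M.value π s - M.optValue s| ≤ 2 * e / (1 - M.γ) + M.γ ^ n / (1 - M.γ) := by
  have h1 := M.valueIter_le_value_of_isGreedy hr hP n hQ he s
  have : Nonempty (Policy S A) := ⟨π⟩
  have h2 : M.optValue s ≤ M.valueIter n s + M.γ ^ n / (1 - M.γ) :=
    ciSup_le fun π' => M.value_le_valueIter hr hP n π' s
  have h3 : M.value π s ≤ M.optValue s :=
    le_ciSup (f := fun π' => M.value π' s)
      ⟨_, by rintro _ ⟨π', rfl⟩; exact M.value_le_valueIter hr hP n π' s⟩ π
  rw [abs_sub_comm, abs_of_nonneg (by linarith)]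
  linarith

/-- Error propagation of approximate value iteration. -/
theorem abs_sub_backup_valueIter_le (hr : ∀ s, Continuous fun a => M.r (s, a))
    (hP : M.IsActionFeller) {L : ℕ} (Q : ℕ → S × A → ℝ) (hQ0 : Q 0 = M.r)
    (hQm : ∀ l, Measurable (Q l)) (hQc : ∀ l s, Continuous fun a => Q l (s, a))
    {b t : ℝ} (hb : 0 ≤ b) (ht : 0 ≤ t)
    (hstep : ∀ l < L, ∀ z, |Q (l + 1) z - M.backup (M.clippedValue (Q l)) z| ≤
      M.γ * (b + t * (1 + (1 - M.γ) * (L - l : ℕ)))) :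
    ∀ l ≤ L, ∀ z, |Q l z - M.backup (M.valueIter l) z| ≤
      M.γ * ((b + 2 * t) / (1 - M.γ) + t * (L - l : ℕ)) := by
  have hγ := M.γ_pos
  have hγ1 := M.one_sub_γ_pos
  intro l
  induction l with
  | zero =>
    intro _ z
    have : Q 0 z - M.backup (M.valueIter 0) z = 0 := by simp [hQ0, backup, valueIter, nextExp]
    rw [this, abs_zero]
    positivity
  | succ l ih =>
    intro hl z
    set e := M.γ * ((b + 2 * t) / (1 - M.γ) + t * (L - l : ℕ)) with he
    have ihl := ih (Nat.le_of_succ_le hl)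
    have hVm := M.measurable_clippedValue (hQm l) (hQc l)
    have hVb := M.abs_clippedValue_le (Q l)
    have hWm := (M.valueIter_spec hr hP (l + 1)).1
    have hWb := M.abs_valueIter_le hr hP (l + 1)
    have hVW : ∀ s, |M.clippedValue (Q l) s - M.valueIter (l + 1) s| ≤ e := fun s => by
      obtain ⟨h0, h1⟩ := (M.valueIter_spec hr hP (l + 1)).2 s
      -- Exact value iteration stays in the clipping range, so clipping, being nonexpansive, cannot
      -- increase the error.
      rw [← M.clip_eq_self h0 h1]
      refine (M.abs_clip_sub_le _ _).trans ?_
      exact abs_ciSup_sub_le (hQc l s) (M.continuous_backup hr hP (M.valueIter_spec hr hP l).1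
        (M.abs_valueIter_le hr hP l) s) fun a => ihl (s, a)
    have h1 := M.nextExp_mono hVm hWm hVb hWb
      (fun s => by linarith [(abs_le.1 (hVW s)).2] :
        ∀ s, M.clippedValue (Q l) s ≤ M.valueIter (l + 1) s + e) z
    have h2 := M.nextExp_mono hWm hVm hWb hVb
      (fun s => by linarith [(abs_le.1 (hVW s)).1] :
        ∀ s, M.valueIter (l + 1) s ≤ M.clippedValue (Q l) s + e) z
    have h3 := abs_le.1 (hstep l hl z)
    have hcast : ((L - l : ℕ) : ℝ) = (L - (l + 1) : ℕ) + 1 := by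
      rw [← Nat.cast_add_one]; congr 1; omega
    -- In fact an equality: the growth t(1-γ)(L-l) of the round and the discounted γt(L-l) add up to
    -- t(L-l). One of the two t per round in b + 2t is the round's own, the other pays for passing
    -- from L - l to L - (l+1).
    have h4 : M.γ * (b + t * (1 + (1 - M.γ) * (L - l : ℕ))) + M.γ * e ≤
        M.γ * ((b + 2 * t) / (1 - M.γ) + t * (L - (l + 1) : ℕ)) := by
      rw [he, ← mul_add]
      refine mul_le_mul_of_nonneg_left ?_ hγ.le
      rw [hcast]
      apply le_of_eq
      field_simp
      ring
    have h5 := mul_le_mul_of_nonneg_left h1 hγ.le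
    have h6 := mul_le_mul_of_nonneg_left h2 hγ.le
    refine le_trans ?_ h4
    unfold backup at h3 ⊢
    rw [abs_le]
    constructor <;> linarith [h3.1, h3.2]

end ValueIteration

end MDP

/-! ### The feature map of the RKHS and the transition density -/

section Density

variable {Z : Type*} {H : Type*} [NormedAddCommGroup H] [InnerProductSpace ℝ H]
  [CompleteSpace H] [RKHS ℝ H Z ℝ]

/-- The canonical feature map of a reproducing kernel Hilbert space. -/
noncomputable def feature (H : Type*) [NormedAddCommGroup H] [InnerProductSpace ℝ H]
    [CompleteSpace H] [RKHS ℝ H Z ℝ] (x : Z) : H := RKHS.kerFun H x (1 : ℝ)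

theorem inner_feature (x : Z) (f : H) : inner ℝ (feature H x) f = f x := by
  simp [feature, RKHS.kerFun_inner]

theorem IsRKHSOf.isFeatureMap {K : Z → Z → ℝ} (h : IsRKHSOf H K) :
    IsFeatureMap (feature H) K := by
  intro x y
  rw [inner_feature, feature, RKHS.kerFun_apply, h x y]

theorem IsFeatureMap.continuous {E : Type*} [NormedAddCommGroup E] [InnerProductSpace ℝ E]
    [TopologicalSpace Z] {φ : Z → E} {K : Z → Z → ℝ} (h : IsFeatureMap φ K)
    (hK : Continuous (Function.uncurry K)) : Continuous φ := by
  refine continuous_iff_continuousAt.2 fun x => ?_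
  rw [ContinuousAt, tendsto_iff_norm_sub_tendsto_zero]
  have h1 : Continuous fun y => √(K y y - 2 * K y x + K x x) := by
    refine Real.continuous_sqrt.comp ?_
    have e1 : Continuous fun y => K y y := hK.comp (continuous_id.prodMk continuous_id)
    have e2 : Continuous fun y => K y x := hK.comp (continuous_id.prodMk continuous_const)
    fun_prop
  have h2 := h1.tendsto x
  have h3 : K x x - 2 * K x x + K x x = 0 := by ring
  rw [h3, Real.sqrt_zero] at h2
  refine h2.congr fun y => ?_
  rw [← h.norm_sq, ← h.norm_sq, ← h y x, ← norm_sub_sq_real, Real.sqrt_sq (norm_nonneg _)]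

variable {S A : Type*} [MeasurableSpace S] [MeasurableSpace A]
  {G : Type*} [NormedAddCommGroup G] [InnerProductSpace ℝ G] [CompleteSpace G]
  [RKHS ℝ G (S × A) ℝ]

/-- The expected next value behaves like a function of norm at most `ν(S) b` in the RKHS. -/
theorem HasBoundedDensity.abs_nextExp_sub_le {M : MDP S A} {ν : Measure S} [IsFiniteMeasure ν]
    (hd : HasBoundedDensity G ν M.P) {W : S → ℝ} (hW : Measurable W) {b : ℝ}
    (hb : ∀ s, |W s| ≤ b) {J : ℕ} (z : Fin J → S × A) (w : Fin J → ℝ) (x : S × A) :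
    |M.nextExp W x - ∑ i, w i * M.nextExp W (z i)| ≤
      ν.real Set.univ * b * ‖feature G x - ∑ i, w i • feature G (z i)‖ := by
  obtain ⟨p, hp0, hpm, hP, hf⟩ := hd
  choose f hfp hfn using hf
  have hpi : ∀ s' y, p s' y = inner ℝ (feature G y) (f s') := fun s' y => by
    rw [inner_feature, hfp]
  have hpb : ∀ s' y, |p s' y| ≤ ‖feature G y‖ := fun s' y => by
    rw [hpi]
    refine (abs_real_inner_le_norm _ _).trans ?_
    exact mul_le_of_le_one_right (norm_nonneg _) (hfn s')
  have hint : ∀ y, Integrable (fun s' => p s' y * W s') ν := fun y => by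
    refine MDP.integrable_of_bounded ((hpm y).mul hW) (b := ‖feature G y‖ * b) fun s' => ?_
    rw [abs_mul]
    exact mul_le_mul (hpb s' y) (hb s') (abs_nonneg _) (norm_nonneg _)
  have hn : ∀ y, M.nextExp W y = ∫ s', p s' y * W s' ∂ν := fun y => by
    rw [MDP.nextExp, hP, integral_withDensity_eq_integral_toReal_smul
      (hpm y).ennreal_ofReal (Filter.Eventually.of_forall fun _ => ENNReal.ofReal_lt_top)]
    refine integral_congr_ae (Filter.Eventually.of_forall fun s' => ?_)
    simp [ENNReal.toReal_ofReal (hp0 s' y)]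
  have hcomb : M.nextExp W x - ∑ i, w i * M.nextExp W (z i) =
      ∫ s', (p s' x * W s' - ∑ i, w i * (p s' (z i) * W s')) ∂ν := by
    rw [integral_sub (hint x) (integrable_finsetSum _ fun i _ => (hint (z i)).const_mul _),
      integral_finsetSum _ fun i _ => (hint (z i)).const_mul _]
    simp only [integral_const_mul, hn]
  -- The estimate is made for each s' separately, by pairing with f s'. The vector ∫ W f dν is never
  -- formed, so s' ↦ f s' need not be measurable.
  have hle : ∀ s', ‖p s' x * W s' - ∑ i, w i * (p s' (z i) * W s')‖ ≤
      ‖feature G x - ∑ i, w i • feature G (z i)‖ * b := fun s' => by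
    have e : p s' x * W s' - ∑ i, w i * (p s' (z i) * W s') =
        inner ℝ (feature G x - ∑ i, w i • feature G (z i)) (f s') * W s' := by
      rw [inner_sub_left, sum_inner, sub_mul, Finset.sum_mul]
      simp only [real_inner_smul_left, hpi, mul_assoc]
    rw [e, norm_mul]
    refine mul_le_mul ?_ (hb s') (norm_nonneg _) (norm_nonneg _)
    exact (norm_inner_le_norm _ _).trans (mul_le_of_le_one_right (norm_nonneg _) (hfn s'))
  rw [hcomb, ← Real.norm_eq_abs]
  refine (norm_integral_le_of_norm_le_const (Filter.Eventually.of_forall hle)).trans_eq ?_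
  ring

/-- Total mass one: the preceding bound for W = 1 and the empty design. -/
theorem HasBoundedDensity.one_le_mul_norm {M : MDP S A} {ν : Measure S} [IsFiniteMeasure ν]
    (hd : HasBoundedDensity G ν M.P) (x : S × A) :
    1 ≤ ν.real Set.univ * ‖feature G x‖ := by
  have h := hd.abs_nextExp_sub_le (W := fun _ => 1) measurable_const (b := 1) (by simp)
    (Fin.elim0 : Fin 0 → S × A) Fin.elim0 x
  simpa [MDP.nextExp] using h

/-- The same bound with one point of weight 1 gives a Lipschitz dependence on the continuous feature
map. -/
theorem HasBoundedDensity.isActionFeller {M : MDP S A} {ν : Measure S} [IsFiniteMeasure ν]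
    [TopologicalSpace S] [TopologicalSpace A] (hd : HasBoundedDensity G ν M.P)
    (hφ : Continuous (feature G : S × A → G)) : M.IsActionFeller := by
  rintro W hW ⟨b, hb⟩ s
  refine continuous_iff_continuousAt.2 fun a => ?_
  rw [ContinuousAt, tendsto_iff_norm_sub_tendsto_zero]
  have h1 : Continuous fun a' => ν.real Set.univ * b *
      ‖feature G (s, a') - feature G (s, a)‖ := by
    have : Continuous fun a' => feature G (s, a') := hφ.comp (by fun_prop)
    fun_prop
  refine squeeze_zero (fun _ => norm_nonneg _) (fun a' => ?_)
    ((h1.tendsto a).trans_eq (by simp))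
  simpa using hd.abs_nextExp_sub_le hW hb (fun _ : Fin 1 => (s, a)) (fun _ => 1) (s, a')

end Density

/-! ### Concentration -/

section Concentration

/-- **Hoeffding's inequality** for a weighted sum of independent evaluations of a bounded
function. -/
theorem measure_pi_weighted_sum_le {S : Type*} [MeasurableSpace S] {J : ℕ} (P : Fin J → Measure S)
    [∀ j, IsProbabilityMeasure (P j)] {G : S → ℝ} (hG : Measurable G) {b : ℝ}
    (hG0 : ∀ s, 0 ≤ G s) (hGb : ∀ s, G s ≤ b) (v : Fin J → ℝ) {σ a : ℝ} (hσ : 0 ≤ σ)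
    (hv : ∑ j, v j * v j ≤ σ ^ 2) (ha : 0 ≤ a) (hb : 0 < b) :
    Measure.pi P {x | σ * b * √(a / 2) < |∑ j, v j * (G (x j) - ∫ s, G s ∂(P j))|} ≤
      ENNReal.ofReal (2 * Real.exp (-a)) := by
  set T := σ * b * √(a / 2) with hT
  have hT0 : 0 ≤ T := by positivity
  set V := ∑ j, v j * v j with hV
  have hV0 : 0 ≤ V := Finset.sum_nonneg fun j _ => mul_self_nonneg _
  set X : Fin J → (Fin J → S) → ℝ := fun j x => v j * (G (x j) - ∫ s, G s ∂(P j)) with hX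
  -- For zero weights the exponent would be a division by 0, but then the event, defined by a strict
  -- inequality, is empty.
  rcases hV0.eq_or_lt with hVz | hVpos
  · have hvz : ∀ j, v j = 0 := fun j => by
      have := (Finset.sum_eq_zero_iff_of_nonneg fun j _ => mul_self_nonneg (v j)).1 hVz.symm j
        (Finset.mem_univ j)
      exact mul_self_eq_zero.1 this
    have : {x : Fin J → S | T < |∑ j, v j * (G (x j) - ∫ s, G s ∂(P j))|} = ∅ := by
      ext x
      simp [hvz, hT0]
    rw [this, measure_empty]
    exact zero_le
  have hind : iIndepFun X (Measure.pi P) :=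
    iIndepFun_pi (X := fun j s => v j * (G s - ∫ s, G s ∂(P j)))
      fun j => ((hG.sub_const _).const_mul _).aemeasurable
  let c : Fin J → NNReal := fun j => ⟨v j ^ 2, sq_nonneg _⟩ * (‖b - 0‖₊ / 2) ^ 2
  have hsub : ∀ j, HasSubgaussianMGF (X j) (c j) (Measure.pi P) := fun j => by
    have h1 := hasSubgaussianMGF_of_mem_Icc (μ := P j) (X := G) hG.aemeasurable
      (Filter.Eventually.of_forall fun s => ⟨hG0 s, hGb s⟩)
    have h2 := h1.const_mul (v j)
    have h3 : Measure.map (fun x : Fin J → S => x j) (Measure.pi P) = P j :=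
      (measurePreserving_eval P j).map_eq
    rw [← h3] at h2
    have h4 := HasSubgaussianMGF.of_map (Y := fun x : Fin J → S => x j)
      (measurable_pi_apply j).aemeasurable h2
    rw [h3] at h4
    exact h4
  have hc : ((∑ j, c j : NNReal) : ℝ) = V * (b ^ 2 / 4) := by
    rw [NNReal.coe_sum, hV, Finset.sum_mul]
    refine Finset.sum_congr rfl fun j _ => ?_
    change v j ^ 2 * (‖b - 0‖ / 2) ^ 2 = _
    rw [sub_zero, Real.norm_of_nonneg hb.le]
    ring
  have hexp : Real.exp (-T ^ 2 / (2 * (∑ j, c j : NNReal))) ≤ Real.exp (-a) := by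
    rw [Real.exp_le_exp, hc, hT, mul_pow, Real.sq_sqrt (by positivity), neg_div, neg_le_neg_iff,
      le_div_iff₀ (by positivity)]
    have := mul_le_mul_of_nonneg_right hv (by positivity : 0 ≤ a * b ^ 2 / 2)
    nlinarith
  have h1 := HasSubgaussianMGF.measure_sum_ge_le_of_iIndepFun hind (s := Finset.univ)
    (fun j _ => hsub j) hT0
  have hind' : iIndepFun (fun j => -X j) (Measure.pi P) :=
    hind.comp (fun _ y => -y) fun _ => measurable_neg
  have h2 := HasSubgaussianMGF.measure_sum_ge_le_of_iIndepFun hind' (s := Finset.univ)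
    (fun j _ => (hsub j).neg) hT0
  have hsubset : {x : Fin J → S | T < |∑ j, v j * (G (x j) - ∫ s, G s ∂(P j))|} ⊆
      {x | T ≤ ∑ j, X j x} ∪ {x | T ≤ ∑ j, (-X j) x} := by
    intro x hx
    have hx' : T < |∑ j, v j * (G (x j) - ∫ s, G s ∂(P j))| := hx
    rcases lt_abs.1 hx' with h | h
    · exact Or.inl h.le
    · refine Or.inr ?_
      change T ≤ ∑ j, -X j x
      rw [Finset.sum_neg_distrib]
      exact h.le
  rw [← ofReal_measureReal]
  refine ENNReal.ofReal_le_ofReal ((measureReal_mono hsubset).trans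
    ((measureReal_union_le _ _).trans ?_))
  rw [two_mul]
  exact add_le_add (h1.trans hexp) (h2.trans hexp)

/-- A set all of whose sections in one coordinate are small is small. -/
theorem measure_pi_le_of_section_le {ι Ω : Type*} [Fintype ι] [DecidableEq ι] [MeasurableSpace Ω]
    (μ : ι → Measure Ω) [∀ i, IsProbabilityMeasure (μ i)] (i : ι) {B : Set (ι → Ω)}
    (hB : MeasurableSet B) {δ : ENNReal}
    (h : ∀ ω, μ i {x | Function.update ω i x ∈ B} ≤ δ) : Measure.pi μ B ≤ δ := by
  have h1 := lintegral_le_of_lmarginal_le (μ := μ) {i} (f := B.indicator 1) (g := fun _ => δ)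
    (measurable_one.indicator hB) measurable_const ?_
  · simpa [lintegral_indicator_one hB] using h1
  · rw [lmarginal_singleton, lmarginal_singleton]
    intro ω
    dsimp only
    have hm : MeasurableSet {x | Function.update ω i x ∈ B} := (measurable_update ω) hB
    have e : (fun x => B.indicator (1 : (ι → Ω) → ENNReal) (Function.update ω i x)) =
        {x | Function.update ω i x ∈ B}.indicator 1 := by
      funext x
      by_cases hx : Function.update ω i x ∈ B <;> simp [Set.indicator, hx]
    rw [e, lintegral_indicator_one hm]
    simpa using h ω

end Concentration

/-! ### Measurability of the algorithm -/

section Algorithm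

variable {S A : Type*} [MeasurableSpace S] [MeasurableSpace A] (M : MDP S A)
  (K : S × A → S × A → ℝ) (lam : ℝ) {J L : ℕ} (z : Fin J → S × A)

theorem observations_succ (ω : Fin L → Fin J → S) (l : ℕ) (h : l + 1 ≤ L) (j : Fin J) :
    observations M K lam z ω (l + 1) h j =
      M.clippedValue (proxyQ M K lam z (observations M K lam z ω l (Nat.le_of_succ_le h)))
        (ω ⟨l, h⟩ j) := rfl

/-- The observations of a round only depend on the samples of the earlier rounds. -/
theorem observations_congr {ω ω' : Fin L → Fin J → S} :
    ∀ (l : ℕ) (h : l ≤ L), (∀ i : Fin L, (i : ℕ) < l → ω i = ω' i) →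
      observations M K lam z ω l h = observations M K lam z ω' l h
  | 0, _, _ => rfl
  | l + 1, h, hω => by
    funext j
    rw [observations_succ, observations_succ,
      observations_congr l (Nat.le_of_succ_le h) fun i hi => hω i (hi.trans l.lt_succ_self),
      hω ⟨l, h⟩ l.lt_succ_self]

/-- The kernel is measurable, and continuous in the action. -/
structure IsActionContinuous {S A : Type*} [MeasurableSpace S] [MeasurableSpace A]
    [TopologicalSpace A] (M : MDP S A) (K : S × A → S × A → ℝ) : Prop where
  measurable_kernel : ∀ y, Measurable fun x => K x y
  continuous_kernel : ∀ y s, Continuous fun a => K (s, a) y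
  continuous_reward : ∀ s, Continuous fun a => M.r (s, a)

theorem measurable_krr (hK : ∀ y, Measurable fun x => K x y) :
    Measurable fun p : (Fin J → ℝ) × (S × A) => krr K lam z p.1 p.2 := by
  unfold krr kvec Matrix.mulVec dotProduct
  refine Finset.measurable_sum _ fun i _ => ((hK (z i)).comp measurable_snd).mul ?_
  exact Finset.measurable_sum _ fun j _ =>
    ((measurable_pi_apply j).comp measurable_fst).const_mul _

theorem measurable_proxyQ (hK : ∀ y, Measurable fun x => K x y) :
    Measurable fun p : (Fin J → ℝ) × (S × A) => proxyQ M K lam z p.1 p.2 :=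
  (M.measurable_r.comp measurable_snd).add ((measurable_krr K lam z hK).const_mul _)

variable {M K}

/-- The estimate of the continuation value before the given round. -/
noncomputable def roundValue {S A : Type*} [MeasurableSpace S] [MeasurableSpace A] (M : MDP S A)
    (K : S × A → S × A → ℝ) (lam : ℝ) {J L : ℕ} (z : Fin J → S × A) (ω : Fin L → Fin J → S)
    (l : Fin L) : S → ℝ :=
  M.clippedValue (proxyQ M K lam z (observations M K lam z ω l l.2.le))

/-- The centered observations of a round. -/
noncomputable def roundNoise {S A : Type*} [MeasurableSpace S] [MeasurableSpace A] (M : MDP S A)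
    (K : S × A → S × A → ℝ) (lam : ℝ) {J L : ℕ} (z : Fin J → S × A) (ω : Fin L → Fin J → S)
    (l : Fin L) (j : Fin J) : ℝ :=
  roundValue M K lam z ω l (ω l j) - M.nextExp (roundValue M K lam z ω l) (z j)

theorem abs_roundNoise_le (ω : Fin L → Fin J → S) (l : Fin L) (j : Fin J) :
    |roundNoise M K lam z ω l j| ≤ 1 / (1 - M.γ) := by
  have h1 : ∀ s, 0 ≤ roundValue M K lam z ω l s := fun s => M.clip_nonneg _
  have h2 : ∀ s, roundValue M K lam z ω l s ≤ 1 / (1 - M.γ) := fun s => M.clip_le _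
  have h3 : 0 ≤ M.nextExp (roundValue M K lam z ω l) (z j) := integral_nonneg h1
  have h4 := (abs_le.1 (M.abs_nextExp_le (W := roundValue M K lam z ω l)
    (M.abs_clippedValue_le _) (z j))).2
  have h5 := h1 (ω l j)
  have h6 := h2 (ω l j)
  unfold roundNoise
  rw [abs_le]
  constructor <;> linarith

variable [TopologicalSpace A]

theorem IsActionContinuous.continuous_proxyQ (hc : IsActionContinuous M K) (Y : Fin J → ℝ)
    (s : S) : Continuous fun a => proxyQ M K lam z Y (s, a) := by
  unfold proxyQ krr kvec dotProduct
  exact (hc.continuous_reward s).add (continuous_const.mul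
    (continuous_finsetSum _ fun i _ => (hc.continuous_kernel (z i) s).mul continuous_const))

theorem IsActionContinuous.measurable_clippedValue_proxyQ
    [TopologicalSpace.SeparableSpace A] (hc : IsActionContinuous M K) :
    Measurable fun p : (Fin J → ℝ) × S => M.clippedValue (proxyQ M K lam z p.1) p.2 := by
  refine M.measurable_clip.comp (measurable_iSup_of_continuous (fun a => ?_) fun p =>
    hc.continuous_proxyQ lam z p.1 p.2)
  exact (measurable_proxyQ M K lam z hc.measurable_kernel).comp
    (measurable_fst.prodMk (measurable_snd.prodMk measurable_const))

theorem IsActionContinuous.measurable_observations [TopologicalSpace.SeparableSpace A]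
    (hc : IsActionContinuous M K) :
    ∀ (l : ℕ) (h : l ≤ L),
      Measurable fun ω : Fin L → Fin J → S => observations M K lam z ω l h
  | 0, _ => measurable_const
  | l + 1, h => by
    have ih := hc.measurable_observations l (Nat.le_of_succ_le h)
    refine measurable_pi_lambda _ fun j => ?_
    exact (hc.measurable_clippedValue_proxyQ lam z).comp
      (ih.prodMk ((measurable_pi_apply j).comp (measurable_pi_apply (⟨l, h⟩ : Fin L))))

/-- Joint measurability is needed: the noise evaluates this function at a sampled state and
integrates it over the state, while the function itself depends on the samples. -/
theorem IsActionContinuous.measurable_roundValue [TopologicalSpace.SeparableSpace A]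
    (hc : IsActionContinuous M K) (l : Fin L) :
    Measurable fun p : (Fin L → Fin J → S) × S => roundValue M K lam z p.1 l p.2 := by
  have h1 : Measurable fun p : (Fin L → Fin J → S) × S =>
      (observations M K lam z p.1 l l.2.le, p.2) :=
    ((hc.measurable_observations lam z l l.2.le).comp measurable_fst).prodMk measurable_snd
  have h2 := (hc.measurable_clippedValue_proxyQ lam z).comp h1
  simp only [Function.comp_def] at h2
  unfold roundValue
  exact h2

theorem IsActionContinuous.measurable_roundNoise [TopologicalSpace.SeparableSpace A]
    (hc : IsActionContinuous M K) (l : Fin L) (j : Fin J) :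
    Measurable fun ω : Fin L → Fin J → S => roundNoise M K lam z ω l j := by
  have h := hc.measurable_roundValue lam z l
  have h1 : Measurable fun ω : Fin L → Fin J → S => (ω, ω l j) :=
    measurable_id.prodMk ((measurable_pi_apply j).comp (measurable_pi_apply l))
  have h2 := h.comp h1
  have h3 := (StronglyMeasurable.integral_prod_right' (ν := M.P (z j))
      h.stronglyMeasurable).measurable
  simp only [Function.comp_def] at h2 h3
  unfold roundNoise MDP.nextExp
  exact h2.sub h3

/-- Concentration of the weighted noise of one round. -/
theorem IsActionContinuous.measure_roundNoise_le [TopologicalSpace.SeparableSpace A]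
    (hc : IsActionContinuous M K) (l : Fin L) (v : Fin J → ℝ) {σ a : ℝ} (hσ : 0 ≤ σ)
    (hv : ∑ j, v j * v j ≤ σ ^ 2) (ha : 0 ≤ a) :
    sampleLaw M L z {ω | σ * (1 / (1 - M.γ)) * √(a / 2) <
      |∑ j, v j * roundNoise M K lam z ω l j|} ≤ ENNReal.ofReal (2 * Real.exp (-a)) := by
  refine measure_pi_le_of_section_le _ l ?_ fun ω => ?_
  · refine measurableSet_lt measurable_const ?_
    exact (Finset.measurable_sum _ fun j _ =>
      (hc.measurable_roundNoise lam z l j).const_mul _).abs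
  -- The value function entering round l ignores the samples of round l. With the other rounds
  -- frozen, the noise is a weighted sum of centered independent terms, so Fubini replaces
  -- conditioning.
  · have e : ∀ x : Fin J → S, roundValue M K lam z (Function.update ω l x) l =
        roundValue M K lam z ω l := fun x => by
      unfold roundValue
      rw [observations_congr M K lam z l l.2.le fun i hi =>
        Function.update_of_ne (Fin.ne_of_lt hi) x ω]
    have e2 : {x : Fin J → S | Function.update ω l x ∈ {ω | σ * (1 / (1 - M.γ)) * √(a / 2) <
        |∑ j, v j * roundNoise M K lam z ω l j|}} =
        {x | σ * (1 / (1 - M.γ)) * √(a / 2) < |∑ j, v j * (roundValue M K lam z ω l (x j) -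
          ∫ s, roundValue M K lam z ω l s ∂(M.P (z j)))|} := by
      ext x
      simp only [Set.mem_ofPred_eq, roundNoise, e, Function.update_self]
      rfl
    rw [e2]
    exact measure_pi_weighted_sum_le (fun j => M.P (z j))
      ((hc.measurable_roundValue lam z l).comp measurable_prodMk_left)
      (fun s => M.clip_nonneg _) (fun s => M.clip_le _) v hσ hv ha
      (one_div_pos.2 M.one_sub_γ_pos)

end Algorithm

/-! ### Elementary inequalities -/

section Elementary

/-- Bernoulli's inequality (1 + y)^κ ≤ 1 + κy; it converts the logarithmic information bound into a
linear one. -/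
theorem mul_log_one_add_le {κ y : ℝ} (hκ0 : 0 ≤ κ) (hκ1 : κ ≤ 1) (hy : 0 ≤ y) :
    κ * Real.log (1 + y) ≤ Real.log (1 + κ * y) := by
  rw [← Real.log_rpow (by positivity)]
  exact Real.log_le_log (by positivity)
    (rpow_one_add_le_one_add_mul_self (by linarith) hκ0 hκ1)

theorem sum_exp_neg_mul_le {x : ℝ} (hx : 0 < x) (L : ℕ) :
    ∑ l ∈ Finset.range L, Real.exp (-(x * (L - l : ℕ))) ≤ 1 / x := by
  induction L with
  | zero => simp [hx.le]
  | succ L ih =>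
    have h1 : ∑ l ∈ Finset.range L, Real.exp (-(x * (L + 1 - l : ℕ))) =
        Real.exp (-x) * ∑ l ∈ Finset.range L, Real.exp (-(x * (L - l : ℕ))) := by
      rw [Finset.mul_sum]
      refine Finset.sum_congr rfl fun l hl => ?_
      have : ((L + 1 - l : ℕ) : ℝ) = (L - l : ℕ) + 1 := by
        rw [← Nat.cast_add_one, Nat.succ_sub (Finset.mem_range.1 hl).le]
      rw [this, ← Real.exp_add]
      congr 1
      ring
    rw [Finset.sum_range_succ, h1]
    have h2 : Real.exp (-(x * (L + 1 - L : ℕ))) = Real.exp (-x) := by simp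
    rw [h2]
    have h3 : (1 + x) * Real.exp (-x) ≤ 1 := by
      rw [Real.exp_neg, ← div_eq_mul_inv, div_le_one (Real.exp_pos _)]
      linarith [Real.add_one_le_exp x]
    have h4 := mul_le_mul_of_nonneg_left ih (Real.exp_pos (-x)).le
    calc _ ≤ Real.exp (-x) * (1 / x) + Real.exp (-x) := by linarith
      _ = ((1 + x) * Real.exp (-x)) / x := by field_simp
      _ ≤ 1 / x := by gcongr

theorem log_one_add_sq_le {y : ℝ} (hy : 0 ≤ y) : Real.log (1 + y) ^ 2 ≤ 4 * y := by
  have h0 : 0 ≤ Real.log (1 + y) := Real.log_nonneg (by linarith)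
  have hs := Real.sqrt_nonneg y
  have h1 : Real.log (1 + y) ≤ 2 * √y := by
    calc Real.log (1 + y) ≤ Real.log ((1 + √y) ^ 2) := by
          refine Real.log_le_log (by positivity) ?_
          nlinarith [Real.sq_sqrt hy]
      _ = 2 * Real.log (1 + √y) := by rw [Real.log_pow]; norm_num
      _ ≤ 2 * √y := by
          have := Real.log_le_sub_one_of_pos (by positivity : 0 < 1 + √y)
          linarith
  calc Real.log (1 + y) ^ 2 ≤ (2 * √y) ^ 2 := by gcongr
    _ = 4 * y := by rw [mul_pow, Real.sq_sqrt hy]; norm_num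

/-- The logarithmic resolution of a net is dominated by the information ratio. -/
theorem mul_log_inv_mul_log_le {s y : ℝ} (hs0 : 0 ≤ s) (hs1 : s ≤ 1) (hy : 0 < y) :
    s * Real.log (1 / min 1 (max s (1 / y))) * Real.log (1 + y) ≤ 7 * Real.log (1 + s * y) := by
  have hly : 0 ≤ Real.log (1 + y) := Real.log_nonneg (by linarith)
  have hsy : 0 ≤ s * y := by positivity
  have hl2 := Real.log_two_gt_d9
  -- Here y stands for λ⁻², and the maximum switches at sy = 1. Below it, log(1/τ) ≤ log(1 + y),
  -- log²(1 + y) ≤ 4y and log(1 + sy) ≥ sy log 2. Above it, log(1 + y) ≤ log(1 + sy) + log(1/s), and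
  -- the remainder s log²(1/s) ≤ 4 is at most 6 log 2; this gives 7 = 1 + 6.
  rcases le_or_gt (s * y) 1 with h | h
  · have h1 : max s (1 / y) = 1 / y := max_eq_right ((le_div_iff₀ hy).2 h)
    have h2 : Real.log (1 / min 1 (1 / y)) ≤ Real.log (1 + y) := by
      have hpos : 0 < min 1 (1 / y) := lt_min one_pos (by positivity)
      refine Real.log_le_log (by positivity) ?_
      rw [div_le_iff₀ hpos]
      rcases min_cases 1 (1 / y) with ⟨e, _⟩ | ⟨e, _⟩ <;> rw [e]
      · linarith
      · rw [mul_one_div, le_div_iff₀ hy]; linarith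
    rw [h1]
    have h3 := mul_log_one_add_le hsy h zero_le_one
    rw [mul_one, show (1 : ℝ) + 1 = 2 by norm_num] at h3
    have h4 := log_one_add_sq_le hy.le
    calc s * Real.log (1 / min 1 (1 / y)) * Real.log (1 + y)
        ≤ s * Real.log (1 + y) * Real.log (1 + y) := by gcongr
      _ = s * Real.log (1 + y) ^ 2 := by ring
      _ ≤ s * (4 * y) := by gcongr
      _ = 4 * (s * y) := by ring
      _ ≤ 7 * (s * y * Real.log 2) := by nlinarith
      _ ≤ _ := by gcongr
  · have hs : 0 < s := by
      rcases hs0.eq_or_lt with h0 | h0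
      · rw [← h0] at h; linarith
      · exact h0
    have h1 : max s (1 / y) = s := max_eq_left ((div_le_iff₀ hy).2 h.le)
    rw [h1, min_eq_right hs1]
    set ℓ := Real.log (1 / s) with hℓ
    have hℓ0 : 0 ≤ ℓ := Real.log_nonneg (by rw [le_div_iff₀ hs]; linarith)
    have h2 : Real.log (1 + y) ≤ Real.log (1 + s * y) + ℓ := by
      rw [hℓ, ← Real.log_mul (by positivity) (by positivity)]
      refine Real.log_le_log (by positivity) ?_
      rw [mul_one_div, le_div_iff₀ hs]
      linarith
    have h3 : s * ℓ ≤ 1 := by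
      have := Real.log_le_sub_one_of_pos (by positivity : 0 < 1 / s)
      calc s * ℓ ≤ s * (1 / s - 1) := by gcongr
        _ = 1 - s := by field_simp
        _ ≤ 1 := by linarith
    have h4 : s * ℓ ^ 2 ≤ 4 := by
      have h5 : ℓ ≤ Real.log (1 + 1 / s) := Real.log_le_log (by positivity) (by linarith)
      have h6 := log_one_add_sq_le (by positivity : 0 ≤ 1 / s)
      calc s * ℓ ^ 2 ≤ s * (4 * (1 / s)) := by
            gcongr
            exact (pow_le_pow_left₀ hℓ0 h5 2).trans h6
        _ = 4 := by field_simp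
    have h7 : Real.log 2 ≤ Real.log (1 + s * y) := Real.log_le_log (by norm_num) (by linarith)
    calc s * ℓ * Real.log (1 + y) ≤ s * ℓ * (Real.log (1 + s * y) + ℓ) := by gcongr
      _ = s * ℓ * Real.log (1 + s * y) + s * ℓ ^ 2 := by ring
      _ ≤ 1 * Real.log (1 + s * y) + 4 :=
          add_le_add (mul_le_mul_of_nonneg_right h3 (by linarith)) h4
      _ ≤ _ := by linarith

/-- The loss √(1 + u) ≤ 1 + u gives the linear growth in the remaining rounds that the discounted
recursion sums exactly. -/
theorem sqrt_mul_one_add_le {a u : ℝ} (hu : 0 ≤ u) : √(a * (1 + u)) ≤ √a * (1 + u) := by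
  rcases le_or_gt 0 a with ha | ha
  · rw [Real.sqrt_mul ha]
    refine mul_le_mul_of_nonneg_left ?_ (Real.sqrt_nonneg _)
    rw [Real.sqrt_le_left (by positivity)]
    nlinarith
  · rw [Real.sqrt_eq_zero_of_nonpos (mul_nonpos_of_nonpos_of_nonneg ha.le (by positivity))]
    positivity

/-- The union bound over the points of a net and over the rounds. -/
theorem sum_union_bound_le {N a η δ : ℝ} (hN : 0 < N) (hη : 0 < η) (hδ : 0 < δ) (ha : 1 ≤ a)
    (haN : Real.log (2 * N / (η * δ)) ≤ a) (L : ℕ) :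
    ∑ l : Fin L, N * (2 * Real.exp (-(a * (1 + η * (L - l : ℕ))))) ≤ δ := by
  have h0 : ∀ l : Fin L, N * (2 * Real.exp (-(a * (1 + η * (L - l : ℕ))))) =
      2 * N * Real.exp (-a) * Real.exp (-(a * η * (L - l : ℕ))) := fun l => by
    rw [show -(a * (1 + η * (L - l : ℕ))) = -a + -(a * η * (L - l : ℕ)) by ring, Real.exp_add]
    ring
  simp only [h0]
  rw [← Finset.mul_sum, Fin.sum_univ_eq_sum_range (fun l => Real.exp (-(a * η * (L - l : ℕ)))) L]
  -- The series over the rounds costs 1/(aη), repaid by the factor η in the logarithm. With η = 1 -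
  -- γ this is why 1 - γ multiplies δ in β.
  have h1 := sum_exp_neg_mul_le (by positivity : 0 < a * η) L
  have h2 : 2 * N * Real.exp (-a) ≤ η * δ := by
    rw [Real.exp_neg, ← div_eq_mul_inv, div_le_iff₀ (Real.exp_pos _), ← div_le_iff₀' (by positivity)]
    exact (Real.log_le_iff_le_exp (by positivity)).1 haN
  calc _ ≤ η * δ * (1 / (a * η)) := by gcongr
    _ = δ / a := by field_simp
    _ ≤ δ := div_le_self hδ.le ha

end Elementary

/-! ### The error of one round -/

section RoundError

variable {S A : Type*} [MeasurableSpace S] [MeasurableSpace A] {M : MDP S A}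
  {K : S × A → S × A → ℝ} {lam : ℝ} {J L : ℕ}
  {H : Type*} [NormedAddCommGroup H] [InnerProductSpace ℝ H] [CompleteSpace H]
  [RKHS ℝ H (S × A) ℝ]

/-- The error of a round is at most the bias plus the regressed noise. -/
theorem IsFeatureMap.abs_proxyQ_sub_backup_le (hφ : IsFeatureMap (feature H) K) (hlam : 0 < lam)
    {ν : Measure S} [IsFiniteMeasure ν] (hd : HasBoundedDensity H ν M.P) {z : Fin J → S × A}
    (ω : Fin L → Fin J → S) (l : Fin L) (x : S × A)
    (hG : Measurable (roundValue M K lam z ω l)) {N : ℝ}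
    (hN : |krr K lam z (roundNoise M K lam z ω l) x| ≤ N) :
    |proxyQ M K lam z (observations M K lam z ω (l + 1) l.2) x -
      M.backup (roundValue M K lam z ω l) x| ≤
      M.γ * (ν.real Set.univ * (1 / (1 - M.γ)) * √(uncertaintySq K lam z x) + N) := by
  set G := roundValue M K lam z ω l with hGdef
  set v := ridgeWeights K lam z x with hv
  have hobs : ∀ j, observations M K lam z ω (l + 1) l.2 j =
      roundNoise M K lam z ω l j + M.nextExp G (z j) := fun j => by
    rw [roundNoise, sub_add_cancel]
    rfl
  have hb := hd.abs_nextExp_sub_le hG (M.abs_clippedValue_le _) z v x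
  have hs : ‖feature H x - ∑ i, v i • feature H (z i)‖ ≤ √(uncertaintySq K lam z x) :=
    Real.le_sqrt_of_sq_le (hφ.norm_sub_ridge_sq_le hlam z x)
  have hb' : |M.nextExp G x - ∑ i, v i * M.nextExp G (z i)| ≤
      ν.real Set.univ * (1 / (1 - M.γ)) * √(uncertaintySq K lam z x) := by
    have := M.one_sub_γ_pos
    exact hb.trans (mul_le_mul_of_nonneg_left hs (by positivity))
  have e : proxyQ M K lam z (observations M K lam z ω (l + 1) l.2) x - M.backup G x =
      M.γ * (krr K lam z (roundNoise M K lam z ω l) x -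
        (M.nextExp G x - ∑ i, v i * M.nextExp G (z i))) := by
    rw [proxyQ, MDP.backup, hφ.krr_eq_ridgeWeights, hφ.krr_eq_ridgeWeights]
    simp only [dotProduct, hobs, mul_add, Finset.sum_add_distrib]
    ring
  rw [e, abs_mul, abs_of_pos M.γ_pos]
  refine mul_le_mul_of_nonneg_left ?_ M.γ_pos.le
  refine (abs_sub _ _).trans ?_
  linarith

/-- Rounding the argument of the regressed noise to a net. -/
theorem IsFeatureMap.abs_krr_roundNoise_le (hφ : IsFeatureMap (feature H) K) (hlam : 0 < lam)
    {z : Fin J → S × A} (ω : Fin L → Fin J → S) (l : Fin L) {η : ℝ} {x y : S × A}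
    (hxy : ∀ f : H, ‖f‖ ≤ 1 → f x - f y ≤ η) :
    |krr K lam z (roundNoise M K lam z ω l) x| ≤
      |krr K lam z (roundNoise M K lam z ω l) y| + √J / (lam * (1 - M.γ)) * η := by
  have hγ := M.one_sub_γ_pos
  set ε := roundNoise M K lam z ω l with hε
  set h : H := ∑ i, ((regGram K lam z)⁻¹.mulVec ε) i • feature H (z i) with hh
  have hk : ∀ x, krr K lam z ε x = h x := fun x => by
    rw [hφ.krr_eq_inner, inner_feature]
  have hη : 0 ≤ η := by simpa using hxy 0 (by simp)
  have hεε : ε ⬝ᵥ ε ≤ J * (1 / (1 - M.γ)) ^ 2 := by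
    have h1 : ∀ j ∈ Finset.univ, ε j * ε j ≤ (1 / (1 - M.γ)) ^ 2 := fun j _ => by
      rw [← pow_two, ← sq_abs]
      exact pow_le_pow_left₀ (abs_nonneg _) (abs_roundNoise_le lam z ω l j) 2
    simpa [dotProduct] using Finset.sum_le_sum h1
  have hnorm : ‖h‖ ≤ √J / (lam * (1 - M.γ)) := by
    have h1 := (hφ.norm_interpolant_sq_le hlam z ε).trans hεε
    refine le_of_sq_le_sq ?_ (by positivity)
    rw [div_pow, Real.sq_sqrt (Nat.cast_nonneg _), le_div_iff₀ (by positivity)]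
    calc ‖h‖ ^ 2 * (lam * (1 - M.γ)) ^ 2 = lam ^ 2 * ‖h‖ ^ 2 * (1 - M.γ) ^ 2 := by ring
      _ ≤ J * (1 / (1 - M.γ)) ^ 2 * (1 - M.γ) ^ 2 := by gcongr
      _ = J := by field_simp
  -- By homogeneity, a net for the unit ball serves every norm.
  have hdiff : ∀ f : H, f x - f y ≤ ‖f‖ * η := fun f => by
    rcases (norm_nonneg f).eq_or_lt with h0 | h0
    · have : f = 0 := norm_eq_zero.1 h0.symm
      simp [this]
    · have h1 := hxy (‖f‖⁻¹ • f) (by rw [norm_smul, norm_inv, norm_norm, inv_mul_cancel₀ h0.ne'])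
      simp only [RKHS.coe_smul, Pi.smul_apply, smul_eq_mul] at h1
      rw [← mul_sub, inv_mul_le_iff₀ h0] at h1
      exact h1
  have h1 := hdiff h
  have h2 := hdiff (-h)
  simp only [RKHS.coe_neg, Pi.neg_apply, norm_neg] at h2
  have h3 : |h x - h y| ≤ ‖h‖ * η := by
    rw [_root_.abs_le]
    constructor <;> linarith
  rw [hk, hk]
  have h4 := abs_sub_abs_le_abs_sub (h x) (h y)
  have h5 := mul_le_mul_of_nonneg_right hnorm hη
  linarith

variable [TopologicalSpace A] [TopologicalSpace.SeparableSpace A]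

/-- With high probability the errors of all rounds are uniformly small. -/
theorem IsActionContinuous.exists_event (hc : IsActionContinuous M K)
    (hφ : IsFeatureMap (feature H) K) (hlam : 0 < lam) {ν : Measure S} [IsFiniteMeasure ν]
    (hd : HasBoundedDensity H ν M.P) (z : Fin J → S × A) {s : ℝ} (hs : 0 ≤ s)
    (hsz : ∀ x, uncertaintySq K lam z x ≤ s) (D : Finset (S × A)) (near : S × A → S × A) {η : ℝ}
    (hnear : ∀ x, near x ∈ D) (hD : ∀ f : H, ‖f‖ ≤ 1 → ∀ x, f x - f (near x) ≤ η) {N a δ : ℝ}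
    (hN : 0 < N) (hDN : (D.card : ℝ) ≤ N) (hδ : 0 < δ) (ha : 1 ≤ a)
    (haN : Real.log (2 * N / ((1 - M.γ) * δ)) ≤ a) :
    ∃ E : Set (Fin L → Fin J → S), MeasurableSet E ∧
      ENNReal.ofReal (1 - δ) ≤ sampleLaw M L z E ∧
      ∀ ω ∈ E, ∀ (l : Fin L) x,
        |proxyQ M K lam z (observations M K lam z ω (l + 1) l.2) x -
          M.backup (roundValue M K lam z ω l) x| ≤
        M.γ * (ν.real Set.univ * (1 / (1 - M.γ)) * √s + √J / (lam * (1 - M.γ)) * η +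
          √s / lam * (1 / (1 - M.γ)) * √(a / 2) * (1 + (1 - M.γ) * (L - l : ℕ))) := by
  have hγ := M.one_sub_γ_pos
  -- Early rounds get a larger exponent, hence a smaller failure probability and a larger tolerance;
  -- this avoids a factor log L.
  let α : Fin L → ℝ := fun l => a * (1 + (1 - M.γ) * (L - l : ℕ))
  have hα : ∀ l, 0 ≤ α l := fun l => by positivity
  let B : Fin L → S × A → Set (Fin L → Fin J → S) := fun l x =>
    {ω | √s / lam * (1 / (1 - M.γ)) * √(α l / 2) <
      |∑ j, ridgeWeights K lam z x j * roundNoise M K lam z ω l j|}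
  have hBm : ∀ l x, MeasurableSet (B l x) := fun l x =>
    measurableSet_lt measurable_const (Finset.measurable_sum _ fun j _ =>
      (hc.measurable_roundNoise lam z l j).const_mul _).abs
  have hBp : ∀ l x, sampleLaw M L z (B l x) ≤ ENNReal.ofReal (2 * Real.exp (-(α l))) :=
    fun l x => by
      refine hc.measure_roundNoise_le lam z l _ (by positivity) ?_ (hα l)
      have h1 := (hφ.ridgeWeights_sq_le hlam z x).trans (hsz x)
      rw [div_pow, Real.sq_sqrt hs, le_div_iff₀ (by positivity), mul_comm]
      exact h1
  set bad : Set (Fin L → Fin J → S) := ⋃ l, ⋃ x ∈ D, B l x with hbad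
  have hbadm : MeasurableSet bad :=
    MeasurableSet.iUnion fun l => Finset.measurableSet_biUnion D fun x _ => hBm l x
  have hprob : IsProbabilityMeasure (sampleLaw M L z) := by
    unfold sampleLaw; infer_instance
  have hbadp : sampleLaw M L z bad ≤ ENNReal.ofReal δ := by
    calc sampleLaw M L z bad ≤ ∑ l, sampleLaw M L z (⋃ x ∈ D, B l x) :=
          measure_iUnion_fintype_le _ _
      _ ≤ ∑ l, ∑ x ∈ D, sampleLaw M L z (B l x) :=
          Finset.sum_le_sum fun l _ => measure_biUnion_finset_le D _
      _ ≤ ∑ l, ∑ _x ∈ D, ENNReal.ofReal (2 * Real.exp (-(α l))) :=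
          Finset.sum_le_sum fun l _ => Finset.sum_le_sum fun x _ => hBp l x
      _ = ENNReal.ofReal (∑ l, (D.card : ℝ) * (2 * Real.exp (-(α l)))) := by
          rw [ENNReal.ofReal_sum_of_nonneg fun l _ => by positivity]
          refine Finset.sum_congr rfl fun l _ => ?_
          rw [Finset.sum_const, nsmul_eq_mul, ENNReal.ofReal_mul (Nat.cast_nonneg _),
            ENNReal.ofReal_natCast]
      _ ≤ ENNReal.ofReal δ := by
          refine ENNReal.ofReal_le_ofReal (le_trans ?_
            (sum_union_bound_le hN hγ hδ ha haN L))
          refine Finset.sum_le_sum fun l _ => ?_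
          exact mul_le_mul_of_nonneg_right hDN (by positivity)
  refine ⟨badᶜ, hbadm.compl, ?_, fun ω hω l x => ?_⟩
  · rw [prob_compl_eq_one_sub hbadm, ENNReal.ofReal_sub _ hδ.le, ENNReal.ofReal_one]
    exact tsub_le_tsub_left hbadp _
  · have hgood : |krr K lam z (roundNoise M K lam z ω l) (near x)| ≤
        √s / lam * (1 / (1 - M.γ)) * √(α l / 2) := by
      by_contra hcon
      refine hω (Set.mem_iUnion.2 ⟨l, Set.mem_iUnion₂.2 ⟨near x, hnear x, ?_⟩⟩)
      rw [hφ.krr_eq_ridgeWeights] at hcon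
      exact not_le.1 hcon
    have h1 := hφ.abs_krr_roundNoise_le (M := M) hlam (z := z) ω l
      (fun f hf => hD f hf x)
    have hG := (hc.measurable_roundValue lam z l).comp (measurable_prodMk_left (x := ω))
    simp only [Function.comp_def] at hG
    have h2 := hφ.abs_proxyQ_sub_backup_le hlam hd ω l x hG h1
    refine h2.trans (mul_le_mul_of_nonneg_left ?_ M.γ_pos.le)
    have h3 : √(α l / 2) ≤ √(a / 2) * (1 + (1 - M.γ) * (L - l : ℕ)) := by
      rw [mul_div_right_comm]
      exact sqrt_mul_one_add_le (by positivity)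
    have h4 := mul_le_mul_of_nonneg_left h3 (by positivity : 0 ≤ √s / lam * (1 / (1 - M.γ)))
    have h5 : ν.real Set.univ * (1 / (1 - M.γ)) * √(uncertaintySq K lam z x) ≤
        ν.real Set.univ * (1 / (1 - M.γ)) * √s :=
      mul_le_mul_of_nonneg_left (Real.sqrt_le_sqrt (hsz x)) (by positivity)
    rw [← mul_assoc] at h4
    linarith

variable [CompactSpace A] [Nonempty A]

/-- Suboptimality of the output policy in terms of the errors of the rounds. -/
theorem IsActionContinuous.abs_value_sub_optValue_le (hc : IsActionContinuous M K)
    (hP : M.IsActionFeller) {z : Fin J → S × A} (ω : Fin L → Fin J → S) {b t : ℝ} (hb : 0 ≤ b)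
    (ht : 0 ≤ t)
    (herr : ∀ (l : Fin L) x, |proxyQ M K lam z (observations M K lam z ω (l + 1) l.2) x -
      M.backup (roundValue M K lam z ω l) x| ≤
        M.γ * (b + t * (1 + (1 - M.γ) * (L - l : ℕ))))
    {π : Policy S A} (hπ : IsGreedy π (outputQ M K lam z ω)) (s : S) :
    |M.value π s - M.optValue s| ≤
      2 * (b + 2 * t) * (M.γ / (1 - M.γ) ^ 2) + M.γ ^ L / (1 - M.γ) := by
  have hγ := M.one_sub_γ_pos
  let Q : ℕ → S × A → ℝ := fun l =>
    if h : l ≤ L then proxyQ M K lam z (observations M K lam z ω l h) else M.r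
  have hQ : ∀ l (h : l ≤ L), Q l = proxyQ M K lam z (observations M K lam z ω l h) :=
    fun l h => dif_pos h
  have hQ0 : Q 0 = M.r := by
    rw [hQ 0 (Nat.zero_le _)]
    funext x
    simp [proxyQ, observations, krr]
  have hQm : ∀ l, Measurable (Q l) := fun l => by
    by_cases h : l ≤ L
    · rw [hQ l h]
      exact (measurable_proxyQ M K lam z hc.measurable_kernel).comp measurable_prodMk_left
    · simpa only [Q, dif_neg h] using M.measurable_r
  have hQc : ∀ l s, Continuous fun a => Q l (s, a) := fun l s => by
    by_cases h : l ≤ L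
    · rw [hQ l h]
      exact hc.continuous_proxyQ lam z _ s
    · simpa only [Q, dif_neg h] using hc.continuous_reward s
  have hmain := M.abs_sub_backup_valueIter_le hc.continuous_reward hP (L := L) Q hQ0 hQm hQc hb ht
    (fun l hl x => by
      rw [hQ (l + 1) hl, hQ l hl.le]
      exact herr ⟨l, hl⟩ x) L le_rfl
  rw [hQ L le_rfl] at hmain
  refine (M.abs_value_sub_optValue_le hc.continuous_reward hP L hπ hmain s).trans_eq ?_
  simp only [Nat.sub_self, Nat.cast_zero, mul_zero, add_zero]
  congr 1
  field_simp

end RoundError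

/-! ### The size of the errors -/

section ErrorSize

/-- The order of the uncertainty of a maximum uncertainty design. -/
noncomputable def uncertaintyBound (lam : ℝ) (J : ℕ) (Γ : ℝ) : ℝ :=
  √(2 * Γ / (Real.log (1 + 1 / lam ^ 2) * J))

variable {lam : ℝ} {J : ℕ} {Γ : ℝ}

theorem log_one_add_inv_sq_pos (hlam : 0 < lam) : 0 < Real.log (1 + 1 / lam ^ 2) :=
  Real.log_pos (lt_add_of_pos_right _ (by positivity))

theorem uncertaintyBound_sq (hlam : 0 < lam) (hΓ : 0 ≤ Γ) :
    uncertaintyBound lam J Γ ^ 2 = 2 * Γ / (Real.log (1 + 1 / lam ^ 2) * J) := by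
  have := log_one_add_inv_sq_pos hlam
  rw [uncertaintyBound, Real.sq_sqrt (by positivity)]

theorem div_le_uncertaintyBound_sq (hlam : 0 < lam) (hJ : 1 ≤ J) (hΓ : 0 ≤ Γ) {q : ℝ}
    (h : J * q ≤ 2 * Γ) :
    q / Real.log (1 + 1 / lam ^ 2) ≤ uncertaintyBound lam J Γ ^ 2 := by
  have h0 := log_one_add_inv_sq_pos hlam
  have hJ' : (0 : ℝ) < J := by exact_mod_cast hJ
  rw [uncertaintyBound_sq hlam hΓ, div_le_div_iff₀ h0 (by positivity)]
  calc q * (Real.log (1 + 1 / lam ^ 2) * J) = J * q * Real.log (1 + 1 / lam ^ 2) := by ring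
    _ ≤ _ := by gcongr

theorem le_uncertaintyBound_sq (hlam : 0 < lam) (hJ : 1 ≤ J) (hΓ : 0 ≤ Γ) {s : ℝ} (hs0 : 0 ≤ s)
    (hs1 : s ≤ 1) (h : J * Real.log (1 + s * (1 / lam ^ 2)) ≤ 2 * Γ) :
    s ≤ uncertaintyBound lam J Γ ^ 2 := by
  refine le_trans ?_ (div_le_uncertaintyBound_sq hlam hJ hΓ h)
  rw [le_div_iff₀ (log_one_add_inv_sq_pos hlam)]
  exact mul_log_one_add_le hs0 hs1 (by positivity)

/-- To be used with x a feature norm: concavity gives x²/J ≤ σ², and cx ≥ 1 removes x. -/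
theorem inv_sqrt_le_mul_uncertaintyBound (hlam : 0 < lam) (hJ : 1 ≤ J) (hΓ : 0 ≤ Γ) {c x : ℝ}
    (hc : 0 ≤ c) (hx1 : x ^ 2 ≤ 1) (hcx : 1 ≤ c * x)
    (h : Real.log (1 + x ^ 2 * (1 / lam ^ 2)) ≤ 2 * Γ) :
    1 / √J ≤ c * uncertaintyBound lam J Γ := by
  have hJ' : (0 : ℝ) < J := by exact_mod_cast hJ
  have h1 : x ^ 2 / J ≤ uncertaintyBound lam J Γ ^ 2 := by
    have h2 := div_le_uncertaintyBound_sq hlam hJ hΓ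
      (q := Real.log (1 + x ^ 2 * (1 / lam ^ 2)) / J) (by rwa [mul_div_cancel₀ _ hJ'.ne'])
    refine le_trans ?_ h2
    rw [le_div_iff₀ (log_one_add_inv_sq_pos hlam), div_mul_eq_mul_div]
    gcongr
    exact mul_log_one_add_le (sq_nonneg x) hx1 (by positivity)
  have h2 : x / √J ≤ uncertaintyBound lam J Γ := by
    refine le_of_sq_le_sq ?_ (Real.sqrt_nonneg _)
    rwa [div_pow, Real.sq_sqrt hJ'.le]
  calc 1 / √J ≤ c * x / √J := by gcongr
    _ = c * (x / √J) := by ring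
    _ ≤ _ := by gcongr

/-- The constant in front of the confidence width. -/
noncomputable def widthConst (cD : ℝ) : ℝ := 4 + 4 * √(3 + 2 * Real.log (1 + 2 * cD) + 7)

theorem four_le_widthConst (cD : ℝ) : 4 ≤ widthConst cD := by
  have := Real.sqrt_nonneg (3 + 2 * Real.log (1 + 2 * cD) + 7)
  unfold widthConst
  linarith

/-- The exponent of the union bound over a net of resolution `√τ / J`. -/
theorem log_card_net_le {cD g δ τ : ℝ} {n d : ℕ} (hcD : 0 < cD) (hg : 0 < g) (hg1 : g ≤ 1)
    (hδ : 0 < δ) (hδ1 : δ ≤ 1) (hJ : 2 ≤ J) (hd : 1 ≤ d) (hτ : 0 < τ) (hn0 : 1 ≤ n)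
    (hn : (n : ℝ) ≤ 2 * (J / √τ)) :
    Real.log (2 * (cD * (n : ℝ) ^ d) / (g * δ)) ≤
      (3 + 2 * Real.log (1 + 2 * cD)) * (d * Real.log (J / (g * δ))) +
        d / 2 * Real.log (1 / τ) := by
  have hJ' : (2 : ℝ) ≤ J := by exact_mod_cast hJ
  have hd' : (1 : ℝ) ≤ d := by exact_mod_cast hd
  have hgδ : g * δ ≤ 1 := mul_le_one₀ hg1 hδ.le hδ1
  have hgδ0 : 0 < g * δ := by positivity
  set ℓ := Real.log (J / (g * δ)) with hℓ
  have e1 : Real.log (2 * (cD * (n : ℝ) ^ d) / (g * δ)) =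
      Real.log (2 * cD) + d * Real.log n - Real.log (g * δ) := by
    rw [Real.log_div (by positivity) hgδ0.ne', ← mul_assoc,
      Real.log_mul (by positivity) (by positivity), Real.log_pow]
  have e2 : Real.log n ≤ Real.log 2 + Real.log J + 1 / 2 * Real.log (1 / τ) := by
    have h1 := Real.log_le_log (by positivity) hn
    rw [Real.log_mul (by norm_num) (by positivity), Real.log_div (by positivity) (by positivity),
      Real.log_sqrt hτ.le] at h1
    rw [one_div τ, Real.log_inv]
    linarith
  have e3 : ℓ = Real.log J - Real.log (g * δ) := Real.log_div (by positivity) hgδ0.ne'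
  have e4 : Real.log (g * δ) ≤ 0 := Real.log_nonpos hgδ0.le hgδ
  have e5 : Real.log 2 ≤ Real.log J := Real.log_le_log (by norm_num) hJ'
  have e6 := Real.log_two_gt_d9
  have hq : Real.log (2 * cD) ≤ Real.log (1 + 2 * cD) :=
    Real.log_le_log (by positivity) (by linarith)
  have hq0 : 0 ≤ Real.log (1 + 2 * cD) := Real.log_nonneg (by linarith)
  set q := Real.log (1 + 2 * cD) with hqdef
  have hdℓ : 1 / 2 ≤ d * ℓ := by nlinarith
  -- The dimension-free log(2 c₀) is absorbed using 1/2 ≤ dℓ, which needs J ≥ 2 and d ≥ 1.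
  have e7 : q ≤ 2 * q * (d * ℓ) := by nlinarith
  have e8 := mul_le_mul_of_nonneg_left e2 (by positivity : (0 : ℝ) ≤ d)
  have e9 : d * (Real.log 2 + Real.log J) - Real.log (g * δ) ≤ 2 * (d * ℓ) := by
    rw [e3]
    nlinarith
  rw [e1]
  nlinarith

/-- The total width of the error in the generic case. -/
theorem error_width_le {cD c g δ s : ℝ} {n d : ℕ} (hcD : 0 < cD) (hc : 0 ≤ c) (hg : 0 < g)
    (hg1 : g ≤ 1) (hδ : 0 < δ) (hδ1 : δ ≤ 1) (hJ : 2 ≤ J) (hd : 1 ≤ d) (hlam : 0 < lam)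
    (hΓ : 0 ≤ Γ) (hs0 : 0 ≤ s) (hs1 : s ≤ 1)
    (hs : J * Real.log (1 + s * (1 / lam ^ 2)) ≤ 2 * Γ)
    (hcJ : 1 / √J ≤ c * uncertaintyBound lam J Γ)
    (hn : J / √(min 1 (max s (1 / (1 / lam ^ 2)))) ≤ n) :
    (c * (1 / g) * √s + √J / (lam * g) * (1 / n)) + 2 * (√s / lam * (1 / g) *
      √(((3 + 2 * Real.log (1 + 2 * cD)) * (d * Real.log (J / (g * δ))) +
        d / 2 * Real.log (1 / min 1 (max s (1 / (1 / lam ^ 2))))) / 2)) ≤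
      widthConst cD * (c / g + 1 / (2 * lam * g) * √(d * Real.log (J / (g * δ)))) *
        uncertaintyBound lam J Γ := by
  have hJ1 : 1 ≤ J := by omega
  have hJ' : (2 : ℝ) ≤ J := by exact_mod_cast hJ
  have hd' : (1 : ℝ) ≤ d := by exact_mod_cast hd
  have hgδ : g * δ ≤ 1 := mul_le_one₀ hg1 hδ.le hδ1
  have hgδ0 : 0 < g * δ := by positivity
  have hly := log_one_add_inv_sq_pos hlam
  set σ := uncertaintyBound lam J Γ with hσ
  set τ := min 1 (max s (1 / (1 / lam ^ 2))) with hτ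
  set ℓ := Real.log (J / (g * δ)) with hℓ
  set C₁ := 3 + 2 * Real.log (1 + 2 * cD) with hC₁
  have hσ0 : 0 ≤ σ := Real.sqrt_nonneg _
  have hC₁0 : 0 ≤ C₁ := by
    have : 0 ≤ Real.log (1 + 2 * cD) := Real.log_nonneg (by linarith)
    positivity
  have hτ0 : 0 < τ := lt_min one_pos (lt_max_of_lt_right (by positivity))
  have hℓ2 : 1 / 2 ≤ ℓ := by
    have h1 : Real.log 2 ≤ ℓ := Real.log_le_log (by norm_num) (by
      rw [le_div_iff₀ hgδ0]; nlinarith)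
    linarith [Real.log_two_gt_d9]
  have hsσ : s ≤ σ ^ 2 := le_uncertaintyBound_sq hlam hJ1 hΓ hs0 hs1 hs
  have hsσ' : √s ≤ σ := Real.sqrt_le_iff.2 ⟨hσ0, hsσ⟩
  have hsT : s * Real.log (1 / τ) ≤ 7 * σ ^ 2 := by
    have h1 := mul_log_inv_mul_log_le hs0 hs1 (by positivity : 0 < 1 / lam ^ 2)
    have h2 := div_le_uncertaintyBound_sq hlam hJ1 hΓ hs
    rw [← le_div_iff₀ hly] at h1
    calc _ ≤ _ := h1
      _ = 7 * (Real.log (1 + s * (1 / lam ^ 2)) / Real.log (1 + 1 / lam ^ 2)) := by ring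
      _ ≤ _ := by gcongr
  have hdℓ : (d : ℝ) / 2 ≤ d * ℓ := by
    have := mul_le_mul_of_nonneg_left hℓ2 (by positivity : (0 : ℝ) ≤ d)
    linarith
  set r := √(d * ℓ) with hr
  have hr2 : r ^ 2 = d * ℓ := Real.sq_sqrt (by positivity)
  have hr1 : 1 ≤ 2 * r := by
    have h1 : (1 / 2 : ℝ) ≤ r := Real.le_sqrt_of_sq_le (by linarith)
    linarith
  have hnoise : √s / lam * (1 / g) * √((C₁ * (d * ℓ) + d / 2 * Real.log (1 / τ)) / 2) ≤
      σ / (lam * g) * (√(C₁ + 7) * r) := by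
    have h1 : √s * √((C₁ * (d * ℓ) + d / 2 * Real.log (1 / τ)) / 2) ≤ σ * (√(C₁ + 7) * r) := by
      rw [← Real.sqrt_mul hs0]
      refine Real.sqrt_le_iff.2 ⟨by positivity, ?_⟩
      rw [mul_pow, mul_pow, Real.sq_sqrt (by positivity), hr2]
      have h2 : d / 2 * (s * Real.log (1 / τ)) ≤ d * ℓ * (7 * σ ^ 2) := by
        refine mul_le_mul hdℓ hsT ?_ (by positivity)
        refine mul_nonneg hs0 (Real.log_nonneg ?_)
        rw [le_div_iff₀ hτ0, one_mul]
        exact min_le_left _ _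
      have h3 : C₁ * (d * ℓ) * s ≤ C₁ * (d * ℓ) * σ ^ 2 := by gcongr
      have h4 : 0 ≤ σ ^ 2 * ((C₁ + 7) * (d * ℓ)) := by positivity
      have h5 : s * ((C₁ * (d * ℓ) + d / 2 * Real.log (1 / τ)) / 2) =
          (C₁ * (d * ℓ) * s + d / 2 * (s * Real.log (1 / τ))) / 2 := by ring
      have h6 : σ ^ 2 * ((C₁ + 7) * (d * ℓ)) =
          C₁ * (d * ℓ) * σ ^ 2 + d * ℓ * (7 * σ ^ 2) := by ring
      linarith
    calc _ = 1 / (lam * g) * (√s * √((C₁ * (d * ℓ) + d / 2 * Real.log (1 / τ)) / 2)) := by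
          field_simp
      _ ≤ 1 / (lam * g) * (σ * (√(C₁ + 7) * r)) := by gcongr
      _ = _ := by ring
  have hround : √J / (lam * g) * (1 / n) ≤ σ / (lam * g) + c * σ / g := by
    have hsJ : 1 ≤ √(J : ℝ) := Real.one_le_sqrt.2 (by linarith)
    have h1 : 1 / (n : ℝ) ≤ √τ / J := by
      rw [div_le_div_iff₀ (lt_of_lt_of_le (by positivity) hn) (by positivity), one_mul]
      rwa [div_le_iff₀' (by positivity)] at hn
    have hexpand : (√s + lam) ^ 2 = s + 2 * √s * lam + lam ^ 2 := by
      rw [add_sq, Real.sq_sqrt hs0]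
    -- Splits the rounding error: √s joins the stochastic term, while λ cancels the 1/λ and leaves
    -- 1/(g√J), bounded by cσ/g.
    have h2 : √τ ≤ √s + lam := by
      refine Real.sqrt_le_iff.2 ⟨by positivity, (min_le_right _ _).trans (max_le ?_ ?_)⟩
      · rw [hexpand]
        have : 0 ≤ 2 * √s * lam + lam ^ 2 := by positivity
        linarith
      · rw [one_div_one_div, hexpand]
        have : 0 ≤ s + 2 * √s * lam := by positivity
        linarith
    calc √J / (lam * g) * (1 / n) ≤ √J / (lam * g) * ((√s + lam) / J) :=
          mul_le_mul_of_nonneg_left (h1.trans (by gcongr)) (by positivity)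
      _ = √s / (lam * g) * (1 / √J) + 1 / √J / g := by
          have : (J : ℝ) = √J * √J := (Real.mul_self_sqrt (by positivity)).symm
          rw [show √(J : ℝ) / (lam * g) * ((√s + lam) / J) =
            √(J : ℝ) / (lam * g) * ((√s + lam) / (√J * √J)) by rw [← this]]
          field_simp
      _ ≤ σ / (lam * g) * 1 + c * σ / g := by
          gcongr
          rw [div_le_one (by positivity)]
          exact hsJ
      _ = _ := by ring
  have hbias : c * (1 / g) * √s ≤ c * σ / g := by
    calc c * (1 / g) * √s ≤ c * (1 / g) * σ := by gcongr
      _ = _ := by ring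
  have hR := Real.sqrt_nonneg (C₁ + 7)
  calc _ ≤ (c * σ / g + (σ / (lam * g) + c * σ / g)) +
        2 * (σ / (lam * g) * (√(C₁ + 7) * r)) := by gcongr
    _ = 2 * (c / g) * σ + σ / (lam * g) * (1 + 2 * (√(C₁ + 7) * r)) := by ring
    -- The lone 1 from rounding is at most 2r, so both stochastic terms are multiples of r.
    _ ≤ (4 + 4 * √(C₁ + 7)) * (c / g) * σ +
        σ / (lam * g) * (2 * r + 2 * (√(C₁ + 7) * r)) := by gcongr; linarith
    _ = _ := by
        rw [widthConst, ← hC₁]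
        field_simp
        ring

end ErrorSize

/-! ### Uniform control of the rounds -/

section Control

open scoped Matrix

variable {S A : Type*} [MeasurableSpace S] [MeasurableSpace A] {M : MDP S A}
  {K : S × A → S × A → ℝ} {lam : ℝ} {J L : ℕ}
  {H : Type*} [NormedAddCommGroup H] [InnerProductSpace ℝ H] [CompleteSpace H]
  [RKHS ℝ H (S × A) ℝ]

/-- With probability at least `1 - δ`, the errors of all the rounds have total width at most `w`:
the error of a round is a constant plus a noise term that may grow with the remaining rounds. -/
def HasErrorWidth (M : MDP S A) (K : S × A → S × A → ℝ) (lam : ℝ) (L : ℕ) {J : ℕ}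
    (z : Fin J → S × A) (δ w : ℝ) : Prop :=
  ∃ (E : Set (Fin L → Fin J → S)) (b t : ℝ), MeasurableSet E ∧
    ENNReal.ofReal (1 - δ) ≤ sampleLaw M L z E ∧ 0 ≤ b ∧ 0 ≤ t ∧ b + 2 * t ≤ w ∧
    ∀ ω ∈ E, ∀ (l : Fin L) x,
      |proxyQ M K lam z (observations M K lam z ω (l + 1) l.2) x -
        M.backup (roundValue M K lam z ω l) x| ≤
      M.γ * (b + t * (1 + (1 - M.γ) * (L - l : ℕ)))

theorem HasErrorWidth.of_forall {z : Fin J → S × A} {δ b w : ℝ} (hδ : 0 < δ) (hb : 0 ≤ b)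
    (hbw : b ≤ w)
    (h : ∀ (ω : Fin L → Fin J → S) (l : Fin L) x,
      |proxyQ M K lam z (observations M K lam z ω (l + 1) l.2) x -
        M.backup (roundValue M K lam z ω l) x| ≤ M.γ * b) : HasErrorWidth M K lam L z δ w := by
  have hprob : IsProbabilityMeasure (sampleLaw M L z) := by
    unfold sampleLaw; infer_instance
  refine ⟨Set.univ, b, 0, MeasurableSet.univ, ?_, hb, le_rfl, by simpa using hbw,
    fun ω _ l x => by simpa using h ω l x⟩
  rw [measure_univ, ← ENNReal.ofReal_one]
  exact ENNReal.ofReal_le_ofReal (by linarith)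

/-- The discounted error propagation of `HasErrorWidth`. -/
theorem HasErrorWidth.exists_event [TopologicalSpace A] [TopologicalSpace.SeparableSpace A]
    [CompactSpace A] [Nonempty A] {z : Fin J → S × A} {δ w : ℝ}
    (h : HasErrorWidth M K lam L z δ w) (hc : IsActionContinuous M K) (hP : M.IsActionFeller) :
    ∃ E : Set (Fin L → Fin J → S), MeasurableSet E ∧
      ENNReal.ofReal (1 - δ) ≤ sampleLaw M L z E ∧
      ∀ ω ∈ E, ∀ π : Policy S A, IsGreedy π (outputQ M K lam z ω) →
        ∀ s, |M.value π s - M.optValue s| ≤ 2 * w * (M.γ / (1 - M.γ) ^ 2) +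
          2 * M.γ ^ (L - 1) * (1 / (1 - M.γ)) ^ 2 := by
  obtain ⟨E, b, t, hE, hEp, hb, ht, hw, herr⟩ := h
  have hγ := M.γ_pos
  have hγ1 := M.one_sub_γ_pos
  refine ⟨E, hE, hEp, fun ω hω π hπ s => ?_⟩
  refine (hc.abs_value_sub_optValue_le hP ω hb ht (herr ω hω) hπ s).trans (add_le_add ?_ ?_)
  · gcongr
  · have h1 : M.γ ^ L ≤ M.γ ^ (L - 1) :=
      pow_le_pow_of_le_one hγ.le M.γ_lt_one.le (Nat.sub_le _ _)
    have h2 : 1 ≤ 1 / (1 - M.γ) := by rw [le_div_iff₀ hγ1]; linarith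
    calc M.γ ^ L / (1 - M.γ) = M.γ ^ L * (1 / (1 - M.γ)) := by ring
      _ ≤ M.γ ^ (L - 1) * ((1 / (1 - M.γ)) * (1 / (1 - M.γ))) :=
          mul_le_mul h1 (le_mul_of_one_le_left (by positivity) h2) (by positivity) (by positivity)
      _ ≤ 2 * (M.γ ^ (L - 1) * ((1 / (1 - M.γ)) * (1 / (1 - M.γ)))) :=
          le_mul_of_one_le_left (by positivity) one_le_two
      _ = _ := by ring

/-- Without randomness there is only the bias of the regression. -/
theorem hasErrorWidth_of_subsingleton [Subsingleton S] (hφ : IsFeatureMap (feature H) K)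
    (hlam : 0 < lam) {ν : Measure S} [IsFiniteMeasure ν] (hd : HasBoundedDensity H ν M.P)
    (z : Fin J → S × A) {s δ : ℝ} (hδ : 0 < δ) (hs : ∀ x, uncertaintySq K lam z x ≤ s) :
    HasErrorWidth M K lam L z δ (ν.real Set.univ * (1 / (1 - M.γ)) * √s) := by
  have hγ1 := M.one_sub_γ_pos
  refine HasErrorWidth.of_forall hδ (by positivity) le_rfl fun ω l x => ?_
  have hnoise : roundNoise M K lam z ω l = 0 := by
    funext j
    have : ∀ s', roundValue M K lam z ω l s' = roundValue M K lam z ω l (ω l j) := fun s' => by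
      rw [Subsingleton.elim s' (ω l j)]
    simp [roundNoise, MDP.nextExp, this]
  have hN : |krr K lam z (roundNoise M K lam z ω l) x| ≤ 0 := by
    rw [hnoise]
    simp [krr]
  refine (hφ.abs_proxyQ_sub_backup_le hlam hd ω l x Subsingleton.measurable hN).trans ?_
  rw [add_zero]
  have := M.γ_pos
  have := Real.sqrt_le_sqrt (hs x)
  gcongr

/-- With a single observation the regressor is dominated by the observation. -/
theorem hasErrorWidth_of_single (hφ : IsFeatureMap (feature H) K) (hlam : 0 < lam)
    {z : Fin 1 → S × A} (hz : IsMaxUncertaintyDesign K lam z) {δ : ℝ} (hδ : 0 < δ) :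
    HasErrorWidth M K lam L z δ (2 * (1 / (1 - M.γ))) := by
  have hγ1 := M.one_sub_γ_pos
  refine HasErrorWidth.of_forall hδ (by positivity) le_rfl fun ω l x => ?_
  set Y := observations M K lam z ω (l + 1) l.2 with hY
  have hY0 : 0 ≤ Y 0 := M.clip_nonneg _
  have hY1 : Y 0 ≤ 1 / (1 - M.γ) := M.clip_le _
  have hdiag : ∀ y, K y y ≤ K (z 0) (z 0) := fun y => hz.diag_le y
  -- The single weight is K(x, z₀)/(K(z₀, z₀) + λ²), and z₀ maximizes the diagonal.
  have hw : |ridgeWeights K lam z x 0| ≤ 1 := by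
    have h1 : regGram K lam z *ᵥ ridgeWeights K lam z x = kvec K z x :=
      hφ.regGram_mulVec_inv hlam z _
    have h2 : (K (z 0) (z 0) + lam ^ 2) * ridgeWeights K lam z x 0 = K x (z 0) := by
      have := congrFun h1 0
      simpa [Matrix.mulVec, dotProduct, regGram, gram, kvec] using this
    have h3 := hφ.abs_le hdiag x (z 0)
    have h4 := hφ.diag_nonneg (z 0)
    rw [← h2, abs_mul, abs_of_pos (by positivity)] at h3
    have h5 : 0 < K (z 0) (z 0) + lam ^ 2 := by positivity
    by_contra hcon
    have h6 := mul_lt_mul_of_pos_left (not_le.1 hcon) h5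
    have h7 : 0 < lam ^ 2 := by positivity
    linarith
  have hkrr : |krr K lam z Y x| ≤ 1 / (1 - M.γ) := by
    rw [hφ.krr_eq_ridgeWeights]
    simp only [dotProduct, Finset.univ_unique, Fin.default_eq_zero, Finset.sum_singleton]
    rw [abs_mul, abs_of_nonneg hY0]
    exact (mul_le_of_le_one_left hY0 hw).trans hY1
  have hnext : |M.nextExp (roundValue M K lam z ω l) x| ≤ 1 / (1 - M.γ) :=
    M.abs_nextExp_le (M.abs_clippedValue_le _) x
  have e : proxyQ M K lam z Y x - M.backup (roundValue M K lam z ω l) x =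
      M.γ * (krr K lam z Y x - M.nextExp (roundValue M K lam z ω l) x) := by
    rw [proxyQ, MDP.backup]
    ring
  rw [e, abs_mul, abs_of_pos M.γ_pos]
  refine mul_le_mul_of_nonneg_left ?_ M.γ_pos.le
  refine (abs_sub _ _).trans ?_
  linarith

/-- The generic case: union bound over a net. -/
theorem IsActionContinuous.hasErrorWidth [TopologicalSpace A]
    [TopologicalSpace.SeparableSpace A] (hc : IsActionContinuous M K)
    (hφ : IsFeatureMap (feature H) K) (hlam : 0 < lam) {ν : Measure S} [IsFiniteMeasure ν]
    (hd : HasBoundedDensity H ν M.P) (z : Fin J → S × A) {cD s δ Γ : ℝ} {d : ℕ} (hcD : 0 < cD)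
    (hdisc : ∀ n : ℕ, 1 ≤ n → ∃ (D : Finset (S × A)) (near : S × A → S × A),
      (D.card : ℝ) ≤ cD * (n : ℝ) ^ d ∧ (∀ x, near x ∈ D) ∧
      ∀ f : H, ‖f‖ ≤ 1 → ∀ x, f x - f (near x) ≤ 1 / n)
    (hs : ∀ x, uncertaintySq K lam z x ≤ s) (hs0 : 0 ≤ s) (hs1 : s ≤ 1)
    (hsΓ : J * Real.log (1 + s * (1 / lam ^ 2)) ≤ 2 * Γ) (hΓ : 0 ≤ Γ)
    (hcJ : 1 / √J ≤ ν.real Set.univ * uncertaintyBound lam J Γ) (hJ : 2 ≤ J) (hd1 : 1 ≤ d)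
    (hδ : 0 < δ) (hδ1 : δ < 1) :
    HasErrorWidth M K lam L z δ
      (widthConst cD * widthOrder (ν.real Set.univ) M.γ lam d J δ * uncertaintyBound lam J Γ) := by
  have hγ1 := M.one_sub_γ_pos
  have hγle : 1 - M.γ ≤ 1 := by linarith [M.γ_pos]
  have hJ' : (2 : ℝ) ≤ J := by exact_mod_cast hJ
  -- The entry 1 / (1 / λ²) is λ²; it keeps τ positive when s = 0, and the cap 1 keeps log(1/τ)
  -- nonnegative.
  set τ := min 1 (max s (1 / (1 / lam ^ 2))) with hτ
  have hτ0 : 0 < τ := lt_min one_pos (lt_max_of_lt_right (by positivity))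
  have hτ1 : √τ ≤ 1 := Real.sqrt_le_one.2 (min_le_left _ _)
  have hsτ : 0 < √τ := Real.sqrt_pos.2 hτ0
  have hJτ : 1 ≤ J / √τ := by rw [le_div_iff₀ hsτ]; linarith
  set n := ⌈J / √τ⌉₊ with hn
  have hn1 : 1 ≤ n := Nat.one_le_iff_ne_zero.2 (Nat.ceil_pos.2 (by linarith)).ne'
  have hnle : (n : ℝ) ≤ 2 * (J / √τ) := by
    have := (Nat.ceil_lt_add_one (by positivity : 0 ≤ (J : ℝ) / √τ)).le
    linarith
  obtain ⟨D, near, hDc, hnear, hD⟩ := hdisc n hn1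
  set ℓ := Real.log (J / ((1 - M.γ) * δ)) with hℓ
  set a := (3 + 2 * Real.log (1 + 2 * cD)) * (d * ℓ) + d / 2 * Real.log (1 / τ) with ha
  have haN := log_card_net_le (δ := δ) (τ := τ) hcD hγ1 hγle hδ hδ1.le hJ hd1 hτ0 hn1 hnle
  have ha1 : 1 ≤ a := by
    have h1 : Real.log 2 ≤ ℓ := by
      refine Real.log_le_log (by norm_num) ?_
      rw [le_div_iff₀ (by positivity)]
      have := mul_le_one₀ hγle hδ.le hδ1.le
      linarith
    have h2 := Real.log_two_gt_d9
    have h3 : 0 ≤ Real.log (1 + 2 * cD) := Real.log_nonneg (by linarith)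
    have h4 : 0 ≤ Real.log (1 / τ) := Real.log_nonneg (by
      rw [le_div_iff₀ hτ0, one_mul]; exact min_le_left _ _)
    have h5 : (1 : ℝ) ≤ d := by exact_mod_cast hd1
    have h6 : 1 * (1 / 2 : ℝ) ≤ d * ℓ := mul_le_mul h5 (by linarith) (by norm_num) (by linarith)
    have h7 : 0 ≤ (d : ℝ) / 2 * Real.log (1 / τ) := by positivity
    have h8 : 3 * (d * ℓ) ≤ (3 + 2 * Real.log (1 + 2 * cD)) * (d * ℓ) :=
      mul_le_mul_of_nonneg_right (by linarith) (by linarith)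
    linarith
  obtain ⟨E, hE, hEp, herr⟩ := hc.exists_event (L := L) hφ hlam hd z hs0 hs D near hnear hD
    (N := cD * (n : ℝ) ^ d) (a := a) (by positivity) hDc hδ ha1 haN
  refine ⟨E, _, _, hE, hEp, ?_, ?_, ?_, herr⟩
  · positivity
  · positivity
  · exact error_width_le hcD measureReal_nonneg hγ1 hγle hδ hδ1.le hJ hd1 hlam hΓ hs0 hs1 hsΓ hcJ
      (Nat.le_ceil _)

end Control

/-! ### Assembly of the cases -/

section Main

variable {S A : Type*} [MeasurableSpace S] [MeasurableSpace A] {M : MDP S A}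
  {K : S × A → S × A → ℝ} {lam : ℝ} {J L : ℕ}
  {H : Type*} [NormedAddCommGroup H] [InnerProductSpace ℝ H] [CompleteSpace H]
  [RKHS ℝ H (S × A) ℝ]

/-- The errors of the rounds of the algorithm have width of order
`β(δ) √(2 Γ(J) / (log (1 + λ⁻²) J))`. -/
theorem IsMaxUncertaintyDesign.hasErrorWidth [TopologicalSpace A]
    [TopologicalSpace.SeparableSpace A] (hc : IsActionContinuous M K)
    (hφ : IsFeatureMap (feature H) K) (hK1 : ∀ x, K x x ≤ 1) (hlam : 0 < lam) {ν : Measure S}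
    [IsFiniteMeasure ν] (hd : HasBoundedDensity H ν M.P) {z : Fin J → S × A}
    (hz : IsMaxUncertaintyDesign K lam z) {cD δ : ℝ} {d : ℕ} (hcD : 0 < cD)
    (hdisc : ∀ n : ℕ, 1 ≤ n → ∃ (D : Finset (S × A)) (near : S × A → S × A),
      (D.card : ℝ) ≤ cD * (n : ℝ) ^ d ∧ (∀ x, near x ∈ D) ∧
      ∀ f : H, ‖f‖ ≤ 1 → ∀ x, f x - f (near x) ≤ 1 / n)
    (hd0 : d = 0 → Subsingleton S) (hJ : 1 ≤ J) (hδ : 0 < δ) (hδ1 : δ < 1) :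
    HasErrorWidth M K lam L z δ (widthConst cD *
      widthOrder (ν.real Set.univ) M.γ lam d J δ * uncertaintyBound lam J (infoGain K lam J)) := by
  have hγ1 := M.one_sub_γ_pos
  have hJ' : (0 : ℝ) < J := by exact_mod_cast hJ
  set c := ν.real Set.univ with hcdef
  have hc0 : 0 ≤ c := measureReal_nonneg
  set Γ := infoGain K lam J with hΓdef
  set σ := uncertaintyBound lam J Γ with hσ
  have hσ0 : 0 ≤ σ := Real.sqrt_nonneg _
  have hΓ : 0 ≤ Γ := by
    have h1 := hz.log_diag_le_infoGain hφ hK1 hlam hJ (z ⟨0, hJ⟩)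
    have h2 := hφ.diag_nonneg (z ⟨0, hJ⟩)
    have h3 : 0 ≤ Real.log (1 + 1 / lam ^ 2 * K (z ⟨0, hJ⟩) (z ⟨0, hJ⟩)) :=
      Real.log_nonneg (le_add_of_nonneg_right (by positivity))
    linarith
  -- The solution of J log(1 + s/λ²) = 2Γ, capped at 1. Linearizing to σ² at once would lose the
  -- control of s log(1/τ).
  set s := min 1 ((Real.exp (2 * Γ / J) - 1) * lam ^ 2) with hsdef
  have hs1 : s ≤ 1 := min_le_left _ _
  have hs0 : 0 ≤ s := by
    refine le_min zero_le_one (mul_nonneg (sub_nonneg.2 (Real.one_le_exp (by positivity))) ?_)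
    positivity
  have hs : ∀ x, uncertaintySq K lam z x ≤ s := fun x => by
    refine le_min ((hφ.uncertaintySq_le_diag hlam z x).trans (hK1 x)) ?_
    have h1 := hz.mul_log_le_infoGain hφ hK1 hlam x
    have h2 := hφ.uncertaintySq_nonneg hlam z x
    rw [← le_div_iff₀' hJ', Real.log_le_iff_le_exp (by positivity), one_div_mul_eq_div,
      ← le_sub_iff_add_le', div_le_iff₀ (by positivity)] at h1
    exact h1
  have hsΓ : J * Real.log (1 + s * (1 / lam ^ 2)) ≤ 2 * Γ := by
    rw [← le_div_iff₀' hJ', Real.log_le_iff_le_exp (by positivity), mul_one_div,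
      ← le_sub_iff_add_le', div_le_iff₀ (by positivity)]
    exact min_le_right _ _
  have hcJ : 1 / √J ≤ c * σ := by
    have h1 := hz.log_diag_le_infoGain hφ hK1 hlam hJ (z ⟨0, hJ⟩)
    have h2 := hφ.norm_sq (z ⟨0, hJ⟩)
    refine inv_sqrt_le_mul_uncertaintyBound hlam hJ hΓ hc0 (x := ‖feature H (z ⟨0, hJ⟩)‖) ?_
      (hd.one_le_mul_norm _) ?_
    · rw [h2]; exact hK1 _
    · rw [h2, mul_comm (K _ _)]; exact h1
  have hsmall : ∀ w, w ≤ 2 * (c / (1 - M.γ) * σ) →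
      w ≤ widthConst cD * widthOrder c M.γ lam d J δ * σ := fun w hw => by
    have h1 : c / (1 - M.γ) ≤ widthOrder c M.γ lam d J δ := by
      have : 0 ≤ 1 / (2 * lam * (1 - M.γ)) * √(d * Real.log (J / ((1 - M.γ) * δ))) := by
        positivity
      unfold widthOrder
      linarith
    have h2 := four_le_widthConst cD
    have h3 : 0 ≤ c / (1 - M.γ) := by positivity
    calc w ≤ 2 * (c / (1 - M.γ)) * σ := by linarith
      _ ≤ _ := by gcongr; linarith
  -- For d = 0 the stochastic part of β vanishes, and indeed there is no noise.
  rcases Nat.eq_zero_or_pos d with h0 | hdpos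
  · have := hd0 h0
    obtain ⟨E, b, t, hE, hEp, hb, ht, hw, herr⟩ :=
      hasErrorWidth_of_subsingleton (L := L) hφ hlam hd z hδ hs
    refine ⟨E, b, t, hE, hEp, hb, ht, hw.trans (hsmall _ ?_), herr⟩
    have h1 : √s ≤ σ := Real.sqrt_le_iff.2 ⟨hσ0, le_uncertaintyBound_sq hlam hJ hΓ hs0 hs1 hsΓ⟩
    calc c * (1 / (1 - M.γ)) * √s ≤ c * (1 / (1 - M.γ)) * σ := by gcongr
      _ = c / (1 - M.γ) * σ := by ring
      _ ≤ _ := le_mul_of_one_le_left (by positivity) one_le_two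
  -- For J = 1 the logarithm in β can be arbitrarily small, so the bias part of β must carry the
  -- whole error; it can, because cσ ≥ 1.
  · rcases hJ.eq_or_lt with h1 | h2
    · subst h1
      obtain ⟨E, b, t, hE, hEp, hb, ht, hw, herr⟩ :=
        hasErrorWidth_of_single (M := M) (L := L) hφ hlam hz hδ
      refine ⟨E, b, t, hE, hEp, hb, ht, hw.trans (hsmall _ ?_), herr⟩
      have h2 : 1 ≤ c * σ := by simpa using hcJ
      calc 2 * (1 / (1 - M.γ)) ≤ 2 * ((c * σ) / (1 - M.γ)) := by gcongr
        _ = _ := by ring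
    · exact hc.hasErrorWidth hφ hlam hd z hcD hdisc hs hs0 hs1 hsΓ hΓ hcJ h2 hdpos hδ hδ1

end Main

end KQ

/-! ### The theorem -/

theorem theorem1 (cD : ℝ) (hcD : 0 < cD) :
    ∃ C : ℝ, 0 < C ∧
      ∀ (m k : ℕ) (S : Set (EuclideanSpace ℝ (Fin m))) (A : Set (EuclideanSpace ℝ (Fin k))),
        IsCompact S → IsCompact A → S.Nonempty → A.Nonempty →
      ∀ (M : KQ.MDP S A), (∀ s, Continuous fun a => M.r (s, a)) →
      ∀ (K : S × A → S × A → ℝ) (H : Type*) [NormedAddCommGroup H] [InnerProductSpace ℝ H]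
        [CompleteSpace H] [RKHS ℝ H (S × A) ℝ],
        KQ.IsRKHSOf H K → Continuous (Function.uncurry K) → (∀ z, K z z ≤ 1) →
        KQ.HasDiscretization H cD →
      ∀ (ν : Measure S) [IsFiniteMeasure ν], KQ.HasBoundedDensity H ν M.P →
      ∀ (lam : ℝ) (J L : ℕ) (δ : ℝ), 0 < lam → 1 ≤ J → 1 ≤ L → 0 < δ → δ < 1 →
      ∀ z : Fin J → S × A, KQ.IsMaxUncertaintyDesign K lam z →
      ∃ E : Set (Fin L → Fin J → S), MeasurableSet E ∧
        ENNReal.ofReal (1 - δ) ≤ KQ.sampleLaw M L z E ∧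
        ∀ ω ∈ E, ∀ π : KQ.Policy S A, KQ.IsGreedy π (KQ.outputQ M K lam z ω) →
          ∀ s, |M.value π s - M.optValue s| ≤
            2 * (C * KQ.widthOrder (ν.real Set.univ) M.γ lam (m + k) J δ) *
                (M.γ / (1 - M.γ) ^ 2) *
                √(2 * KQ.infoGain K lam J / (Real.log (1 + 1 / lam ^ 2) * J)) +
              2 * M.γ ^ (L - 1) * (1 / (1 - M.γ)) ^ 2 := by
  refine ⟨KQ.widthConst cD, by linarith [KQ.four_le_widthConst cD], ?_⟩
  intro m k S A _ hA _ hAn M hr K H _ _ _ _ hH hK hK1 hdisc ν _ hd lam J L δ hlam hJ _ hδ hδ1 z hz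
  have : CompactSpace A := isCompact_iff_compactSpace.1 hA
  have : Nonempty A := hAn.to_subtype
  have hφ := hH.isFeatureMap
  have hc : KQ.IsActionContinuous M K :=
    { measurable_kernel := fun y =>
        (hK.comp (continuous_id.prodMk continuous_const)).measurable
      continuous_kernel := fun y s =>
        hK.comp ((continuous_const.prodMk continuous_id).prodMk continuous_const)
      continuous_reward := hr }
  have hwidth := hz.hasErrorWidth (L := L) hc hφ hK1 hlam hd (d := m + k) hcD
    (fun n hn => by
      -- Only B = 1 is used, so the factor B^d disappears from the size of the net.
      obtain ⟨D, near, h1, h2, h3⟩ := hdisc n 1 hn le_rfl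
      exact ⟨D, near, by simpa using h1, fun x => (h2 x).1, h3⟩)
    (fun h0 => by
      obtain rfl : m = 0 := by omega
      infer_instance) hJ hδ hδ1
  obtain ⟨E, hE, hEp, hbound⟩ := hwidth.exists_event hc (hd.isActionFeller (hφ.continuous hK))
  refine ⟨E, hE, hEp, fun ω hω π hπ s => (hbound ω hω π hπ s).trans_eq ?_⟩
  rw [KQ.uncertaintyBound]
  ring
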